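/- For each $n\ge 1$ let $m_n\ge n$ be an integer, and suppose that $n/m_n\to\lambda\in[0,1]$ as $n\to\infty$; if $\lambda=0$, suppose also that there is $\alpha<2$ such that $m_n\le n^\alpha$ for all large $n$. Let $\mathbb K=\mathbb R$ and $\beta=1$, or $\mathbb K=\mathbb C$ and $\beta=2$. Let $M_n$ be deterministic $n\times m_n$ matrices over $\mathbb K$ whose $n$ singular values (counted with multiplicity, zeros included) are all strictly less than a constant $K$ independent of $n$, and suppose that the singular law of $M_n$ (the uniform distribution on its $n$ singular values) converges weakly to a probability measure $\mu$ as $n\to\infty$. Let $U_n$, $V_n$ be independent Haar-distributed orthogonal (if $\mathbb K=\mathbb R$) or unitary (if $\mathbb K=\mathbb C$) random matrices of sizes $n\times n$ and $m_n\times m_n$, and let $E_n$ be an $m_n\times n$ elementary matrix, i.e. all its entries are zero except one, which equals one. For $\theta\in\mathbb R$ define $$I_n(\theta)=\frac1n\log\mathbb E\exp\left[\sqrt{n m_n}\,\theta\,\Re\operatorname{Tr}(E_nU_nM_nV_n)\right].$$ The rectangular $R$-transform $C_\mu^{(\lambda)}$ of $\mu$ with ratio $\lambda$ is defined as follows. Put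 $M_{\mu^2}(z)=\int\frac{t^2z}{1-t^2z}\,d\mu(t)$ for $z\in[0,K^{-2})$, $T^{(\lambda)}(z)=(\lambda z+1)(z+1)$, which is a bijection from $[-1,\infty)$ onto $[0,\infty)$, and $H_\mu^{(\lambda)}(z)=z\,T^{(\lambda)}(M_{\mu^2}(z))$, which is a bijection from $[0,K^{-2})$ onto an interval containing $[0,K^{-2})$. With ${T^{(\lambda)}}^{-1}$ and ${H_\mu^{(\lambda)}}^{-1}$ the inverses of these two bijections, put $C_\mu^{(\lambda)}(0)=0$ and $$C_\mu^{(\lambda)}(z)={T^{(\lambda)}}^{-1}\left(\frac{z}{{H_\mu^{(\lambda)}}^{-1}(z)}\right)\qquad (z\ne0).$$ Then $I(\theta)=\beta\int_0^{\theta/\beta}\frac{C_\mu^{(\lambda)}(t^2)}{t}\,dt$ is well defined (the integrand is integrable) for every $\theta\in(-\beta K^{-1},\beta K^{-1})$, and $I_n$ converges to $I$ uniformly on every compact subset of $(-\beta K^{-1},\beta K^{-1})$. -/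

import Mathlib

open Filter Topology MeasureTheory ProbabilityTheory Set
open scoped Matrix

noncomputable section

/-! ### Singular values and singular law of a rectangular matrix -/

/-- The singular values of an `n × m` matrix `M`, in decreasing order. For `n ≤ m` these are the
`n` singular values of `M`, counted with multiplicity, the zero ones included. -/
def singularValue {𝕜 : Type*} [RCLike 𝕜] {n m : ℕ} (M : Matrix (Fin n) (Fin m) 𝕜)
    (k : Fin n) : ℝ :=
  (Matrix.toEuclideanLin M).singularValues k

/-- The singular law of an `n × m` matrix (`n ≤ m`): the uniform distribution on its
`n` singular values. -/
def singularLaw {𝕜 : Type*} [RCLike 𝕜] {n m : ℕ} (M : Matrix (Fin n) (Fin m) 𝕜) : Measure ℝ :=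
  (n : ENNReal)⁻¹ • ∑ k : Fin n, Measure.dirac (singularValue M k)

/-! ### The rectangular `R`-transform -/

/-- Generating function of the moments of the push-forward of `μ` by `t ↦ t ^ 2`. -/
def momentGenSq (μ : Measure ℝ) (z : ℝ) : ℝ :=
  ∫ t, t ^ 2 * z / (1 - t ^ 2 * z) ∂μ

/-- `T^(lam)(z) = (lam z + 1)(z + 1)`. -/
def rectT (lam z : ℝ) : ℝ := (lam * z + 1) * (z + 1)

/-- The inverse of the bijection `T^(lam) : [-1, ∞) → [0, ∞)`. -/
def rectTInv (lam : ℝ) : ℝ → ℝ := Function.invFunOn (rectT lam) (Ici (-1))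

/-- `H_μ^(lam)(z) = z T^(lam)(M_{μ²}(z))`. -/
def rectH (lam : ℝ) (μ : Measure ℝ) (z : ℝ) : ℝ := z * rectT lam (momentGenSq μ z)

/-- For `μ` supported in `[-K, K]`, the inverse of the (injective) function
`H_μ^(lam)` on `[0, K⁻²)`. -/
def rectHInv (K lam : ℝ) (μ : Measure ℝ) : ℝ → ℝ :=
  Function.invFunOn (rectH lam μ) (Ico 0 ((K ^ 2)⁻¹))

/-- The rectangular `R`-transform with ratio `lam` of a probability measure `μ` supported in
`[-K, K]`. The number `K` only determines the domain, which is the image of `[0, K⁻²)`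
under `H_μ^(lam)` and contains `[0, K⁻²)`. -/
def rectRTransform (K lam : ℝ) (μ : Measure ℝ) (z : ℝ) : ℝ :=
  if z = 0 then 0 else rectTInv lam (z / rectHInv K lam μ z)

/-! ### Haar matrices and spherical integrals -/

/-- The Borel `σ`-algebra of the orthogonal (`𝕜 = ℝ`) or unitary (`𝕜 = ℂ`) group. -/
instance unitaryGroupMeasurableSpace {𝕜 : Type*} [RCLike 𝕜] (n : ℕ) :
    MeasurableSpace (Matrix.unitaryGroup (Fin n) 𝕜) := borel _

instance unitaryGroupBorelSpace {𝕜 : Type*} [RCLike 𝕜] (n : ℕ) :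
    BorelSpace (Matrix.unitaryGroup (Fin n) 𝕜) := ⟨rfl⟩

/-- `U` is a Haar-distributed random orthogonal (`𝕜 = ℝ`) or unitary (`𝕜 = ℂ`) matrix on the
probability space `(Ω, P)`. -/
def IsHaarDistributed {𝕜 : Type*} [RCLike 𝕜] {n : ℕ} {Ω : Type*} [MeasurableSpace Ω]
    (P : Measure Ω) (U : Ω → Matrix.unitaryGroup (Fin n) 𝕜) : Prop :=
  Measurable U ∧ (P.map U).IsHaarMeasure

/-- `E` is an elementary matrix: all its entries are `0`, except one, which is `1`. -/
def IsElementary {𝕜 : Type*} [RCLike 𝕜] {m n : ℕ} (E : Matrix (Fin m) (Fin n) 𝕜) : Prop :=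
  ∃ i j, E = Matrix.single i j 1

/-- `(1 / n) log 𝔼 exp (√(n m) θ Re Tr (E U M V))`. -/
def rectSphericalIntegral {𝕜 : Type*} [RCLike 𝕜] {n m : ℕ} {Ω : Type*} [MeasurableSpace Ω]
    (P : Measure Ω) (E : Matrix (Fin m) (Fin n) 𝕜) (U : Ω → Matrix.unitaryGroup (Fin n) 𝕜)
    (M : Matrix (Fin n) (Fin m) 𝕜) (V : Ω → Matrix.unitaryGroup (Fin m) 𝕜) (θ : ℝ) : ℝ :=
  1 / (n : ℝ) * Real.log (∫ ω, Real.exp (√((n : ℝ) * (m : ℝ)) * θ *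
    RCLike.re (Matrix.trace (E * (U ω : Matrix (Fin n) (Fin n) 𝕜) * M *
      (V ω : Matrix (Fin m) (Fin m) 𝕜)))) ∂P)

/-- `β = 1` for real matrices, `β = 2` for complex matrices: the dimension of `𝕜` over `ℝ`. -/
def betaIndex (𝕜 : Type*) [RCLike 𝕜] : ℝ := (Module.finrank ℝ 𝕜 : ℝ)

theorem betaIndex_real : betaIndex ℝ = 1 := by
  simp [betaIndex]

theorem betaIndex_complex : betaIndex ℂ = 2 := by
  simp [betaIndex, Complex.finrank_real_complex]

/-- The limit `I(θ) = β ∫₀^{θ/β} C_μ^(lam)(t²) / t dt`. -/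
def rectLimit (β K lam : ℝ) (μ : Measure ℝ) (θ : ℝ) : ℝ :=
  β * ∫ t in (0 : ℝ)..(θ / β), rectRTransform K lam μ (t ^ 2) / t

end

/-! ### Haar measure on the unitary group and averaging over spheres -/

section Unitary

variable {𝕜 : Type*} [RCLike 𝕜] {n : ℕ}

/-! Put t = θ/β and N = βn/2. If E has its entry 1 at (i, j), the trace equals ⟪U⁻¹eⱼ, M V eᵢ⟫, a
sesquilinear form at independent uniform points of two unit spheres. Giving these points independent
Gaussian radii produces Gaussian vectors g, h, for which 𝔼 exp(√x Re⟪g, M h⟫) = ∏ⱼ (1 - sⱼ²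
x)^(-β/2). Let p_k ≥ 0 be the Taylor coefficients of this product. Dividing out the radial moments
𝔼‖g‖^(2k) = 2^k ∏_{i<k} (βn/2 + i), and likewise for h, gives the exact formula Σ_k p_k t^(2k) /
∏_{i<k} T(i/N) for the spherical expectation, where T has ratio n/m (`hasSum_singularCoeff`,
`integral_exp_trace_eq_tsum`).

The series is then treated by Laplace's method (`tendsto_log_weighted_series`). Here Σ_k p_k x^k =
exp(N φₙ(x)) with φₙ → φ = `logPotentialSq μ`. Writing t² = x T(κ), the k-th term is p_k x^k
exp(Σ_{i<k} log(T(κ)/T(i/N))). The weights p_k x^k concentrate near k = N x φ'(x) = N M_{μ²}(x), and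
the exponent peaks near k = Nκ because T increases. For κ = M_{μ²}(x), that is x = H⁻¹(t²), both
peaks coincide, and (1/N) log of the series tends to φ(x) + ∫₀^κ log(T(κ)/T(z)) dz.

As a function of y = H(x) this limit has derivative C(y)/y (`hasDerivAt_rectPrimitive_rectHInv`).
The substitution y = s² and the factor N/n = β/2 turn it into I(θ). Finally, the prelimit functions
are monotone in |θ| and the limit is continuous, so pointwise convergence is locally uniform
(`tendstoUniformlyOn_Icc_of_monotoneOn`). -/

instance unitaryGroup_locallyCompactSpace :
    LocallyCompactSpace (Matrix.unitaryGroup (Fin n) 𝕜) := by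
  have : LocallyCompactSpace (Matrix (Fin n) (Fin n) 𝕜) :=
    inferInstanceAs (LocallyCompactSpace (Fin n → Fin n → 𝕜))
  have : T1Space (Matrix (Fin n) (Fin n) 𝕜) :=
    inferInstanceAs (T1Space (Fin n → Fin n → 𝕜))
  exact (isClosed_unitary (R := Matrix (Fin n) (Fin n) 𝕜)).locallyCompactSpace

theorem measurable_unitaryGroup_entry (i j : Fin n) :
    Measurable fun U : Matrix.unitaryGroup (Fin n) 𝕜 => (U : Matrix (Fin n) (Fin n) 𝕜) i j :=
  (continuous_subtype_val.matrix_elem i j).measurable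

/-- A right translate of a left Haar probability measure is again one, and such a measure is unique.
-/
theorem isMulRightInvariant_of_isHaarMeasure (ν : Measure (Matrix.unitaryGroup (Fin n) 𝕜))
    [ν.IsHaarMeasure] [IsProbabilityMeasure ν] : ν.IsMulRightInvariant := by
  refine ⟨fun g => ?_⟩
  have : (ν.map (· * g)).IsHaarMeasure := Measure.isHaarMeasure_map_mul_right ν g
  have : IsProbabilityMeasure (ν.map (· * g)) :=
    Measure.isProbabilityMeasure_map (continuous_mul_const g).measurable.aemeasurable
  exact Measure.isHaarMeasure_eq_of_isProbabilityMeasure _ _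

theorem toEuclideanLin_mul_apply {a b c : ℕ} (A : Matrix (Fin a) (Fin b) 𝕜)
    (B : Matrix (Fin b) (Fin c) 𝕜) (v : EuclideanSpace 𝕜 (Fin c)) :
    Matrix.toEuclideanLin (A * B) v = Matrix.toEuclideanLin A (Matrix.toEuclideanLin B v) := by
  ext i
  simp [Matrix.mulVec_mulVec]

theorem inner_toEuclideanLin_left {a b : ℕ} (A : Matrix (Fin a) (Fin b) 𝕜)
    (v : EuclideanSpace 𝕜 (Fin b)) (w : EuclideanSpace 𝕜 (Fin a)) :
    inner 𝕜 (Matrix.toEuclideanLin A v) w =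
      inner 𝕜 v (Matrix.toEuclideanLin A.conjTranspose w) := by
  rw [Matrix.toEuclideanLin_conjTranspose_eq_adjoint, LinearMap.adjoint_inner_right]

theorem toEuclideanLin_real_smul {a b : ℕ} (A : Matrix (Fin a) (Fin b) 𝕜) (c : ℝ)
    (v : EuclideanSpace 𝕜 (Fin b)) :
    Matrix.toEuclideanLin A (c • v) = c • Matrix.toEuclideanLin A v :=
  LinearMap.map_smul ((Matrix.toEuclideanLin A).restrictScalars ℝ) c v

theorem norm_toEuclideanLin_unitary (U : Matrix.unitaryGroup (Fin n) 𝕜)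
    (v : EuclideanSpace 𝕜 (Fin n)) :
    ‖Matrix.toEuclideanLin (U : Matrix (Fin n) (Fin n) 𝕜) v‖ = ‖v‖ := by
  have h : (U : Matrix (Fin n) (Fin n) 𝕜).conjTranspose * (U : Matrix (Fin n) (Fin n) 𝕜) = 1 :=
    (Matrix.mem_unitaryGroup_iff'.1 U.2)
  have h2 : ‖Matrix.toEuclideanLin (U : Matrix (Fin n) (Fin n) 𝕜) v‖ ^ 2 = ‖v‖ ^ 2 := by
    rw [← inner_self_eq_norm_sq (𝕜 := 𝕜), ← inner_self_eq_norm_sq (𝕜 := 𝕜),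
      inner_toEuclideanLin_left, ← toEuclideanLin_mul_apply, h]
    simp
  exact (sq_eq_sq₀ (norm_nonneg _) (norm_nonneg _)).1 h2

/-- The real linear isometry of `𝕜ⁿ` given by a unitary matrix. -/
noncomputable def unitaryIsometry (U : Matrix.unitaryGroup (Fin n) 𝕜) :
    EuclideanSpace 𝕜 (Fin n) ≃ₗᵢ[ℝ] EuclideanSpace 𝕜 (Fin n) :=
  LinearIsometry.toLinearIsometryEquiv
    ⟨(Matrix.toEuclideanLin (U : Matrix (Fin n) (Fin n) 𝕜)).restrictScalars ℝ,
      norm_toEuclideanLin_unitary U⟩ rfl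

theorem unitaryIsometry_apply (U : Matrix.unitaryGroup (Fin n) 𝕜)
    (v : EuclideanSpace 𝕜 (Fin n)) :
    unitaryIsometry U v = Matrix.toEuclideanLin (U : Matrix (Fin n) (Fin n) 𝕜) v := rfl

/-- The unnormalized standard Gaussian measure `exp (-‖v‖² / 2) dv` on `𝕜ⁿ`. -/
noncomputable def gaussianWeight (𝕜 : Type*) [RCLike 𝕜] (n : ℕ) : Measure (EuclideanSpace 𝕜 (Fin n)) :=
  volume.withDensity fun v => ENNReal.ofReal (Real.exp (-‖v‖ ^ 2 / 2))

theorem measurable_gaussianDensity :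
    Measurable fun v : EuclideanSpace 𝕜 (Fin n) => ENNReal.ofReal (Real.exp (-‖v‖ ^ 2 / 2)) := by
  fun_prop

theorem lintegral_gaussianWeight {f : EuclideanSpace 𝕜 (Fin n) → ENNReal} (hf : Measurable f) :
    ∫⁻ v, f v ∂(gaussianWeight 𝕜 n) =
      ∫⁻ v, ENNReal.ofReal (Real.exp (-‖v‖ ^ 2 / 2)) * f v := by
  rw [gaussianWeight, lintegral_withDensity_eq_lintegral_mul _ measurable_gaussianDensity hf]
  rfl

instance : SFinite (gaussianWeight 𝕜 n) := by
  unfold gaussianWeight; infer_instance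

theorem lintegral_gaussianWeight_unitary {f : EuclideanSpace 𝕜 (Fin n) → ENNReal}
    (hf : Measurable f) (U : Matrix.unitaryGroup (Fin n) 𝕜) :
    ∫⁻ v, f (Matrix.toEuclideanLin (U : Matrix (Fin n) (Fin n) 𝕜) v) ∂(gaussianWeight 𝕜 n) =
      ∫⁻ v, f v ∂(gaussianWeight 𝕜 n) := by
  have hU : Measurable fun v : EuclideanSpace 𝕜 (Fin n) => unitaryIsometry U v :=
    (unitaryIsometry U).continuous.measurable
  simp_rw [← unitaryIsometry_apply]
  rw [lintegral_gaussianWeight hf, lintegral_gaussianWeight (f := fun v => f (unitaryIsometry U v)) (hf.comp hU),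
    ← (unitaryIsometry U).measurePreserving.lintegral_comp
      (f := fun v => ENNReal.ofReal (Real.exp (-‖v‖ ^ 2 / 2)) * f v)
      (measurable_gaussianDensity.mul hf)]
  simp

/-- Transitivity on spheres: complete v/‖v‖ to an orthonormal basis having it in position i, and
take the change of basis matrix. -/
theorem exists_unitary_apply_single (i : Fin n) (v : EuclideanSpace 𝕜 (Fin n)) :
    ∃ W : Matrix.unitaryGroup (Fin n) 𝕜,
      Matrix.toEuclideanLin (W : Matrix (Fin n) (Fin n) 𝕜)
        (‖v‖ • EuclideanSpace.single i (1 : 𝕜)) = v := by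
  by_cases hv : v = 0
  · exact ⟨1, by simp [hv]⟩
  have hv' : ‖v‖ ≠ 0 := by simpa using hv
  have hu : ‖(‖v‖⁻¹ • v)‖ = 1 := by
    rw [norm_smul, norm_inv, norm_norm, inv_mul_cancel₀ hv']
  obtain ⟨b, hb⟩ := Orthonormal.exists_orthonormalBasis_extension_of_card_eq (𝕜 := 𝕜)
    (E := EuclideanSpace 𝕜 (Fin n)) (ι := Fin n) (by simp) (v := fun _ => ‖v‖⁻¹ • v) (s := {i})
    (by
      rw [orthonormal_iff_ite]
      rintro ⟨a, ha⟩ ⟨c, hc⟩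
      obtain rfl : a = i := ha
      obtain rfl : c = a := hc
      simp [Set.domRestrict, inner_self_eq_norm_sq_to_K, hu])
  refine ⟨⟨(EuclideanSpace.basisFun (Fin n) 𝕜).toBasis.toMatrix b,
    OrthonormalBasis.toMatrix_orthonormalBasis_mem_unitary _ _⟩, ?_⟩
  have h1 : Matrix.toEuclideanLin ((EuclideanSpace.basisFun (Fin n) 𝕜).toBasis.toMatrix b)
      (EuclideanSpace.single i (1 : 𝕜)) = b i := by
    ext j
    simp [Module.Basis.toMatrix_apply]
  rw [toEuclideanLin_real_smul, h1, hb i rfl, smul_inv_smul₀ hv']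

theorem measurable_toEuclideanLin_unitary :
    Measurable fun q : Matrix.unitaryGroup (Fin n) 𝕜 × EuclideanSpace 𝕜 (Fin n) =>
      Matrix.toEuclideanLin (q.1 : Matrix (Fin n) (Fin n) 𝕜) q.2 := by
  have : Measurable fun q : Matrix.unitaryGroup (Fin n) 𝕜 × EuclideanSpace 𝕜 (Fin n) =>
      WithLp.toLp 2 fun i => ∑ j, (q.1 : Matrix (Fin n) (Fin n) 𝕜) i j * q.2 j := by
    refine (WithLp.measurable_toLp 2 _).comp (measurable_pi_iff.2 fun i => ?_)
    refine Finset.measurable_fun_sum _ fun j _ => ?_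
    refine ((measurable_unitaryGroup_entry i j).comp measurable_fst).mul ?_
    have : Measurable fun v : EuclideanSpace 𝕜 (Fin n) => v j := by fun_prop
    exact this.comp measurable_snd
  convert this using 2 with q
  ext i
  simp [Matrix.mulVec, dotProduct]

/-- Polar decomposition of the Gaussian without spherical measure. Average f(Uv) over both U and v.
Integrating in v first removes U by rotation invariance; integrating in U first gives ‖v‖^d times
the value at eᵢ, by right invariance and homogeneity. -/
theorem lintegral_unitary_mul_lintegral_norm_pow (ν : Measure (Matrix.unitaryGroup (Fin n) 𝕜))
    [IsProbabilityMeasure ν] [ν.IsMulRightInvariant] (i : Fin n) (d : ℕ)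
    {f : EuclideanSpace 𝕜 (Fin n) → ENNReal} (hf : Measurable f)
    (hhom : ∀ (c : ℝ) v, 0 ≤ c → f (c • v) = ENNReal.ofReal c ^ d * f v) :
    (∫⁻ U, f (Matrix.toEuclideanLin (U : Matrix (Fin n) (Fin n) 𝕜)
        (EuclideanSpace.single i (1 : 𝕜))) ∂ν) *
      (∫⁻ v, ENNReal.ofReal ‖v‖ ^ d ∂(gaussianWeight 𝕜 n)) =
    ∫⁻ v, f v ∂(gaussianWeight 𝕜 n) := by
  have hmeas : Measurable fun q : Matrix.unitaryGroup (Fin n) 𝕜 × EuclideanSpace 𝕜 (Fin n) =>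
      f (Matrix.toEuclideanLin (q.1 : Matrix (Fin n) (Fin n) 𝕜) q.2) :=
    hf.comp measurable_toEuclideanLin_unitary
  have key : ∀ v : EuclideanSpace 𝕜 (Fin n),
      ∫⁻ U, f (Matrix.toEuclideanLin (U : Matrix (Fin n) (Fin n) 𝕜) v) ∂ν =
        (∫⁻ U, f (Matrix.toEuclideanLin (U : Matrix (Fin n) (Fin n) 𝕜)
          (EuclideanSpace.single i (1 : 𝕜))) ∂ν) * ENNReal.ofReal ‖v‖ ^ d := by
    intro v
    -- Since v = W(‖v‖ eᵢ), right translation by W absorbs the direction of v, and homogeneity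
    -- extracts its length.
    obtain ⟨W, hW⟩ := exists_unitary_apply_single i v
    have h1 : ∀ U : Matrix.unitaryGroup (Fin n) 𝕜,
        f (Matrix.toEuclideanLin (U : Matrix (Fin n) (Fin n) 𝕜) v) =
        (fun U : Matrix.unitaryGroup (Fin n) 𝕜 =>
          ENNReal.ofReal ‖v‖ ^ d * f (Matrix.toEuclideanLin (U : Matrix (Fin n) (Fin n) 𝕜)
            (EuclideanSpace.single i (1 : 𝕜)))) (U * W) := by
      intro U
      simp only [Submonoid.coe_mul]
      rw [← hhom _ _ (norm_nonneg v)]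
      congr 1
      rw [toEuclideanLin_mul_apply]
      conv_lhs => rw [← hW]
      rw [toEuclideanLin_real_smul, toEuclideanLin_real_smul]
    rw [lintegral_congr h1]
    refine (lintegral_mul_right_eq_self (μ := ν) (fun U : Matrix.unitaryGroup (Fin n) 𝕜 =>
      ENNReal.ofReal ‖v‖ ^ d * f (Matrix.toEuclideanLin (U : Matrix (Fin n) (Fin n) 𝕜)
        (EuclideanSpace.single i (1 : 𝕜)))) W).trans ?_
    rw [lintegral_const_mul' _ _ (by finiteness), mul_comm]
  calc _ = ∫⁻ v, (∫⁻ U, f (Matrix.toEuclideanLin (U : Matrix (Fin n) (Fin n) 𝕜) v) ∂ν)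
          ∂(gaussianWeight 𝕜 n) := by
        rw [lintegral_congr key, lintegral_const_mul _ (by fun_prop)]
    _ = ∫⁻ U, ∫⁻ v, f (Matrix.toEuclideanLin (U : Matrix (Fin n) (Fin n) 𝕜) v)
          ∂(gaussianWeight 𝕜 n) ∂ν := lintegral_lintegral_swap (hmeas.comp measurable_swap).aemeasurable
    _ = _ := by
        rw [lintegral_congr fun U => lintegral_gaussianWeight_unitary hf U, lintegral_const,
          measure_univ, mul_one]

end Unitary

/-! ### Gaussian integrals on `𝕜ⁿ` -/

section Gaussian

variable {𝕜 : Type*} [RCLike 𝕜] {n : ℕ}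

theorem finrank_real_euclideanSpace :
    (Module.finrank ℝ (EuclideanSpace 𝕜 (Fin n)) : ℝ) = betaIndex 𝕜 * n := by
  have h := Module.finrank_mul_finrank ℝ 𝕜 (EuclideanSpace 𝕜 (Fin n))
  rw [finrank_euclideanSpace_fin] at h
  rw [betaIndex, ← h]
  push_cast
  ring

theorem betaIndex_pos : 0 < betaIndex 𝕜 := by
  unfold betaIndex
  exact_mod_cast Module.finrank_pos

theorem integrableOn_pow_mul_exp_neg_sq_half (d : ℕ) :
    IntegrableOn (fun y : ℝ => y ^ d * Real.exp (-y ^ 2 / 2)) (Ioi 0) := by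
  refine (integrableOn_rpow_mul_exp_neg_mul_sq (b := 1 / 2) (by norm_num) (s := (d : ℝ))
    (by have : (0 : ℝ) ≤ d := by positivity
        linarith)).congr_fun (fun y _ => ?_) measurableSet_Ioi
  simp only [Real.rpow_natCast]
  congr 2
  ring

theorem integral_pow_mul_exp_neg_sq_half (d : ℕ) :
    ∫ y in Ioi (0 : ℝ), y ^ d * Real.exp (-y ^ 2 / 2) =
      (1 / 2) ^ (-((d : ℝ) + 1) / 2) * (1 / 2) * Real.Gamma (((d : ℝ) + 1) / 2) := by
  rw [← integral_rpow_mul_exp_neg_mul_rpow (p := 2) (q := d) (b := 1 / 2) (by norm_num)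
    (by have : (0 : ℝ) ≤ d := by positivity
        linarith) (by norm_num)]
  refine setIntegral_congr_fun measurableSet_Ioi (fun y _ => ?_)
  simp only [Real.rpow_natCast, Real.rpow_ofNat]
  congr 2
  ring

theorem integral_pow_add_two_mul_exp_neg_sq_half (d : ℕ) :
    ∫ y in Ioi (0 : ℝ), y ^ (d + 2) * Real.exp (-y ^ 2 / 2) =
      ((d : ℝ) + 1) * ∫ y in Ioi (0 : ℝ), y ^ d * Real.exp (-y ^ 2 / 2) := by
  rw [integral_pow_mul_exp_neg_sq_half, integral_pow_mul_exp_neg_sq_half]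
  have h1 : (((d + 2 : ℕ) : ℝ) + 1) / 2 = ((d : ℝ) + 1) / 2 + 1 := by push_cast; ring
  have h2 : -(((d + 2 : ℕ) : ℝ) + 1) / 2 = -((d : ℝ) + 1) / 2 + (-1) := by push_cast; ring
  rw [h1, h2, Real.Gamma_add_one (by positivity), Real.rpow_add (by norm_num), Real.rpow_neg_one]
  ring

theorem integrable_norm_pow_mul_exp [NeZero n] (k : ℕ) :
    Integrable fun v : EuclideanSpace 𝕜 (Fin n) => ‖v‖ ^ k * Real.exp (-‖v‖ ^ 2 / 2) := by
  rw [integrable_fun_norm_addHaar volume (f := fun y => y ^ k * Real.exp (-y ^ 2 / 2))]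
  refine (integrableOn_pow_mul_exp_neg_sq_half
    (Module.finrank ℝ (EuclideanSpace 𝕜 (Fin n)) - 1 + k)).congr_fun (fun y _ => ?_)
    measurableSet_Ioi
  simp only [smul_eq_mul, pow_add, mul_assoc]

/-- In polar coordinates this is the recursion Γ(s + 1) = s Γ(s) for the radial integral, in real
dimension βn. -/
theorem integral_norm_pow_add_two_mul_exp [NeZero n] (k : ℕ) :
    ∫ v : EuclideanSpace 𝕜 (Fin n), ‖v‖ ^ (k + 2) * Real.exp (-‖v‖ ^ 2 / 2) =
      (betaIndex 𝕜 * n + k) *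
        ∫ v : EuclideanSpace 𝕜 (Fin n), ‖v‖ ^ k * Real.exp (-‖v‖ ^ 2 / 2) := by
  have hd : 0 < Module.finrank ℝ (EuclideanSpace 𝕜 (Fin n)) := Module.finrank_pos
  rw [integral_fun_norm_addHaar volume (f := fun y => y ^ k * Real.exp (-y ^ 2 / 2)),
    integral_fun_norm_addHaar volume (f := fun y => y ^ (k + 2) * Real.exp (-y ^ 2 / 2)),
    ← finrank_real_euclideanSpace]
  set D := Module.finrank ℝ (EuclideanSpace 𝕜 (Fin n))
  have h := integral_pow_add_two_mul_exp_neg_sq_half (D - 1 + k)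
  -- The radial exponent D - 1 is a truncated subtraction, harmless because D > 0.
  have h3 : ((D - 1 + k : ℕ) : ℝ) + 1 = D + k := by
    rw [← Nat.cast_succ, ← Nat.cast_add]
    congr 1
    omega
  rw [h3] at h
  have e1 : ∀ j : ℕ, ∀ y : ℝ, y ^ (D - 1) • (y ^ j * Real.exp (-y ^ 2 / 2)) =
      y ^ (D - 1 + j) * Real.exp (-y ^ 2 / 2) := fun j y => by
    rw [smul_eq_mul, pow_add, mul_assoc]
  simp_rw [e1, ← add_assoc, h]
  simp only [nsmul_eq_mul, smul_eq_mul]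
  ring

theorem integral_norm_pow_mul_exp [NeZero n] (k : ℕ) :
    ∫ v : EuclideanSpace 𝕜 (Fin n), ‖v‖ ^ (2 * k) * Real.exp (-‖v‖ ^ 2 / 2) =
      (4 ^ k * ∏ i ∈ Finset.range k, ((betaIndex 𝕜 * n / 2 + i) / 2)) *
        ∫ v : EuclideanSpace 𝕜 (Fin n), Real.exp (-‖v‖ ^ 2 / 2) := by
  induction k with
  | zero => simp
  | succ k ih =>
    rw [show 2 * (k + 1) = 2 * k + 2 by ring, integral_norm_pow_add_two_mul_exp, ih,
      Finset.prod_range_succ]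
    push_cast
    ring

theorem gaussianWeight_univ [NeZero n] :
    gaussianWeight 𝕜 n univ =
      ENNReal.ofReal (∫ v : EuclideanSpace 𝕜 (Fin n), Real.exp (-‖v‖ ^ 2 / 2)) := by
  have h := integrable_norm_pow_mul_exp (𝕜 := 𝕜) (n := n) 0
  simp only [pow_zero, one_mul] at h
  rw [ofReal_integral_eq_lintegral_ofReal h (ae_of_all _ fun v => by positivity), gaussianWeight,
    withDensity_apply _ MeasurableSet.univ, Measure.restrict_univ]

theorem gaussianWeight_univ_ne_top [NeZero n] : gaussianWeight 𝕜 n univ ≠ ⊤ := by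
  rw [gaussianWeight_univ]; exact ENNReal.ofReal_ne_top

theorem gaussianWeight_univ_ne_zero : gaussianWeight 𝕜 n univ ≠ 0 := by
  rw [gaussianWeight, withDensity_apply _ MeasurableSet.univ, Measure.restrict_univ]
  rw [Ne, lintegral_eq_zero_iff measurable_gaussianDensity]
  intro h
  have h2 : ∀ᵐ v : EuclideanSpace 𝕜 (Fin n), False := by
    filter_upwards [h] with v hv
    have := Real.exp_pos (-‖v‖ ^ 2 / 2)
    simp at hv
    linarith
  simp only [eventually_false_iff_eq_bot, ae_eq_bot] at h2
  exact NeZero.ne _ h2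

theorem lintegral_norm_pow_gaussianWeight [NeZero n] (k : ℕ) :
    ∫⁻ v, ENNReal.ofReal ‖v‖ ^ (2 * k) ∂(gaussianWeight 𝕜 n) =
      ENNReal.ofReal (4 ^ k * ∏ i ∈ Finset.range k, ((betaIndex 𝕜 * n / 2 + i) / 2)) *
        gaussianWeight 𝕜 n univ := by
  have hb := betaIndex_pos (𝕜 := 𝕜)
  rw [gaussianWeight_univ, ← ENNReal.ofReal_mul (by positivity), ← integral_norm_pow_mul_exp,
    ofReal_integral_eq_lintegral_ofReal (integrable_norm_pow_mul_exp (2 * k))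
      (ae_of_all _ fun v => by positivity), lintegral_gaussianWeight (by fun_prop)]
  refine lintegral_congr fun v => ?_
  rw [mul_comm, ENNReal.ofReal_mul (by positivity), ENNReal.ofReal_pow (norm_nonneg _)]

/-- Complete the square and translate by a. -/
theorem lintegral_exp_re_inner_gaussianWeight (a : EuclideanSpace 𝕜 (Fin n)) :
    ∫⁻ v, ENNReal.ofReal (Real.exp (RCLike.re (inner 𝕜 a v))) ∂(gaussianWeight 𝕜 n) =
      ENNReal.ofReal (Real.exp (‖a‖ ^ 2 / 2)) * gaussianWeight 𝕜 n univ := by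
  have h1 : ∀ v : EuclideanSpace 𝕜 (Fin n), ENNReal.ofReal (Real.exp (-‖v‖ ^ 2 / 2)) *
      ENNReal.ofReal (Real.exp (RCLike.re (inner 𝕜 a v))) =
      ENNReal.ofReal (Real.exp (‖a‖ ^ 2 / 2)) *
        ENNReal.ofReal (Real.exp (-‖v - a‖ ^ 2 / 2)) := by
    intro v
    rw [← ENNReal.ofReal_mul (by positivity), ← ENNReal.ofReal_mul (by positivity), ← Real.exp_add,
      ← Real.exp_add, @norm_sub_sq 𝕜, inner_re_symm]
    congr 2
    ring
  rw [lintegral_gaussianWeight (by fun_prop), lintegral_congr h1,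
    lintegral_const_mul' _ _ ENNReal.ofReal_ne_top,
    lintegral_sub_right_eq_self (fun v : EuclideanSpace 𝕜 (Fin n) =>
      ENNReal.ofReal (Real.exp (-‖v‖ ^ 2 / 2))) a, gaussianWeight,
    withDensity_apply _ MeasurableSet.univ, Measure.restrict_univ]

/-- The map B, diagonal in the basis b with entries √(1 - cⱼ), carries the integrand to the standard
Gaussian. Its determinant over ℝ is the norm from 𝕜 to ℝ of the one over 𝕜, which is where the
exponent β/2 arises. -/
theorem lintegral_exp_diagonal_gaussianWeight
    (b : OrthonormalBasis (Fin n) 𝕜 (EuclideanSpace 𝕜 (Fin n))) (c : Fin n → ℝ)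
    (hc : ∀ j, c j < 1) :
    ∫⁻ v, ENNReal.ofReal (Real.exp ((∑ j, c j * ‖b.repr v j‖ ^ 2) / 2)) ∂(gaussianWeight 𝕜 n) =
      ENNReal.ofReal (∏ j, (1 - c j) ^ (-(betaIndex 𝕜 / 2))) * gaussianWeight 𝕜 n univ := by
  classical
  have hc' : ∀ j, 0 < 1 - c j := fun j => sub_pos.2 (hc j)
  set B : EuclideanSpace 𝕜 (Fin n) →ₗ[𝕜] EuclideanSpace 𝕜 (Fin n) :=
    Matrix.toLin b.toBasis b.toBasis (Matrix.diagonal fun j => ((√(1 - c j) : ℝ) : 𝕜)) with hB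
  have hBnorm : ∀ v, ‖B v‖ ^ 2 = ‖v‖ ^ 2 - ∑ j, c j * ‖b.repr v j‖ ^ 2 := by
    intro v
    have h0 : ∀ j, b.repr (B v) j = ((√(1 - c j) : ℝ) : 𝕜) * b.repr v j := by
      intro j
      have := congrFun (Matrix.repr_toLin b.toBasis b.toBasis
        (Matrix.diagonal fun j => ((√(1 - c j) : ℝ) : 𝕜)) v) j
      simpa [Matrix.mulVec_diagonal] using this
    rw [← b.repr.norm_map (B v), ← b.repr.norm_map v, EuclideanSpace.norm_sq_eq,
      EuclideanSpace.norm_sq_eq, ← Finset.sum_sub_distrib]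
    refine Finset.sum_congr rfl fun j _ => ?_
    rw [h0, norm_mul, mul_pow, RCLike.norm_ofReal, sq_abs, Real.sq_sqrt (hc' j).le]
    ring
  have hdet : LinearMap.det (B.restrictScalars ℝ) = ∏ j, (1 - c j) ^ (betaIndex 𝕜 / 2) := by
    rw [LinearMap.det_restrictScalars, hB, LinearMap.det_toLin, Matrix.det_diagonal,
      ← RCLike.ofReal_prod, ← RCLike.algebraMap_eq_ofReal, Algebra.norm_algebraMap,
      ← Finset.prod_pow]
    refine Finset.prod_congr rfl fun j _ => ?_
    rw [Real.sqrt_eq_rpow, ← Real.rpow_natCast, ← Real.rpow_mul (hc' j).le, betaIndex]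
    congr 1
    ring
  have hpos : 0 < ∏ j, (1 - c j) ^ (betaIndex 𝕜 / 2) :=
    Finset.prod_pos fun j _ => Real.rpow_pos_of_pos (hc' j) _
  have hmeasB : Measurable fun v => B v := B.continuous_of_finiteDimensional.measurable
  have h1 : ∀ v : EuclideanSpace 𝕜 (Fin n), ENNReal.ofReal (Real.exp (-‖v‖ ^ 2 / 2)) *
      ENNReal.ofReal (Real.exp ((∑ j, c j * ‖b.repr v j‖ ^ 2) / 2)) =
      ENNReal.ofReal (Real.exp (-‖B v‖ ^ 2 / 2)) := by
    intro v
    rw [← ENNReal.ofReal_mul (by positivity), ← Real.exp_add, hBnorm]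
    congr 2
    ring
  have hrep : ∀ j, Measurable fun v => b.repr v j := fun j => by
    have : Continuous fun v => b.repr v := b.repr.continuous
    fun_prop
  rw [lintegral_gaussianWeight (by fun_prop), lintegral_congr h1,
    ← lintegral_map (f := fun v => ENNReal.ofReal (Real.exp (-‖v‖ ^ 2 / 2)))
      measurable_gaussianDensity hmeasB]
  have h2 := Measure.map_linearMap_addHaar_eq_smul_addHaar
    (volume : Measure (EuclideanSpace 𝕜 (Fin n))) (f := B.restrictScalars ℝ)
    (by rw [hdet]; exact hpos.ne')
  rw [LinearMap.coe_restrictScalars] at h2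
  rw [h2, lintegral_smul_measure, gaussianWeight, withDensity_apply _ MeasurableSet.univ,
    Measure.restrict_univ, hdet, abs_of_pos (inv_pos.2 hpos), ← Finset.prod_inv_distrib]
  simp_rw [Real.rpow_neg (hc' _).le]
  rfl

/-- Diagonalize T*T; its eigenvalues are the squared singular values. -/
theorem norm_sq_apply_eq_sum_singularValues {m : ℕ}
    (T : EuclideanSpace 𝕜 (Fin m) →ₗ[𝕜] EuclideanSpace 𝕜 (Fin n)) :
    ∃ b : OrthonormalBasis (Fin m) 𝕜 (EuclideanSpace 𝕜 (Fin m)),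
      ∀ v, ‖T v‖ ^ 2 = ∑ j : Fin m, T.singularValues j ^ 2 * ‖b.repr v j‖ ^ 2 := by
  have hm : Module.finrank 𝕜 (EuclideanSpace 𝕜 (Fin m)) = m := by simp
  set hT := T.isSymmetric_adjoint_comp_self
  refine ⟨hT.eigenvectorBasis hm, fun v => ?_⟩
  set b := hT.eigenvectorBasis hm
  have h1 : ‖T v‖ ^ 2 = RCLike.re (inner 𝕜 v ((LinearMap.adjoint T ∘ₗ T) v)) := by
    rw [LinearMap.comp_apply, LinearMap.adjoint_inner_right, inner_self_eq_norm_sq]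
  rw [h1, ← b.repr.inner_map_map, PiLp.inner_apply, map_sum]
  refine Finset.sum_congr rfl fun j _ => ?_
  rw [hT.eigenvectorBasis_apply_self_apply hm, T.sq_singularValues_fin hm]
  rw [RCLike.inner_apply, mul_assoc, RCLike.mul_conj, ← RCLike.ofReal_pow, ← RCLike.ofReal_mul,
    RCLike.ofReal_re]

theorem lintegral_exp_norm_sq_gaussianWeight {m : ℕ}
    (T : EuclideanSpace 𝕜 (Fin m) →ₗ[𝕜] EuclideanSpace 𝕜 (Fin n)) (x : ℝ)
    (hx : ∀ j : Fin m, T.singularValues j ^ 2 * x < 1) :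
    ∫⁻ v, ENNReal.ofReal (Real.exp (x * ‖T v‖ ^ 2 / 2)) ∂(gaussianWeight 𝕜 m) =
      ENNReal.ofReal (∏ j : Fin m, (1 - T.singularValues j ^ 2 * x) ^ (-(betaIndex 𝕜 / 2))) *
        gaussianWeight 𝕜 m univ := by
  obtain ⟨b, hb⟩ := norm_sq_apply_eq_sum_singularValues T
  rw [← lintegral_exp_diagonal_gaussianWeight b _ hx]
  refine lintegral_congr fun v => ?_
  rw [hb, Finset.mul_sum]
  congr 4
  ext j
  ring

end Gaussian

/-! ### Power series expansion of the spherical integral -/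

section Expansion

variable {𝕜 : Type*} [RCLike 𝕜] {n m : ℕ}

theorem ofReal_cosh_eq_tsum (r X : ℝ) :
    ENNReal.ofReal (Real.cosh (r * X)) =
      ∑' k : ℕ, ENNReal.ofReal ((r ^ 2) ^ k / (2 * k).factorial) *
        ENNReal.ofReal (X ^ (2 * k)) := by
  have hnn : ∀ k : ℕ, 0 ≤ (r * X) ^ (2 * k) / (2 * k).factorial := fun k =>
    div_nonneg ((even_two_mul k).pow_nonneg _) (by positivity)
  rw [← (Real.hasSum_cosh (r * X)).tsum_eq, ENNReal.ofReal_tsum_of_nonneg hnn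
    (Real.hasSum_cosh (r * X)).summable]
  refine tsum_congr fun k => ?_
  rw [← ENNReal.ofReal_mul (by positivity), mul_pow, ← pow_mul]
  congr 1
  ring

/-- Replacing exp by cosh for a symmetric variable leaves a series with nonnegative terms, so sum
and integral can be exchanged in `ENNReal` with no integrability check. -/
theorem lintegral_cosh_of_lintegral_exp {α : Type*} [MeasurableSpace α] {ν : Measure α}
    {X : α → ℝ} (hX : Measurable X) {A : ENNReal}
    (h1 : ∫⁻ a, ENNReal.ofReal (Real.exp (X a)) ∂ν = A)
    (h2 : ∫⁻ a, ENNReal.ofReal (Real.exp (-X a)) ∂ν = A) :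
    ∫⁻ a, ENNReal.ofReal (Real.cosh (X a)) ∂ν = A := by
  have h : ∀ a, ENNReal.ofReal (Real.cosh (X a)) = ENNReal.ofReal (1 / 2) *
      (ENNReal.ofReal (Real.exp (X a)) + ENNReal.ofReal (Real.exp (-X a))) := by
    intro a
    rw [← ENNReal.ofReal_add (by positivity) (by positivity),
      ← ENNReal.ofReal_mul (by norm_num), Real.cosh_eq]
    congr 1
    ring
  rw [lintegral_congr h, lintegral_const_mul' _ _ ENNReal.ofReal_ne_top,
    lintegral_add_left (by fun_prop), h1, h2, ← two_mul, ← mul_assoc]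
  have : ENNReal.ofReal (1 / 2) * 2 = 1 := by
    rw [show (2 : ENNReal) = ENNReal.ofReal 2 by simp, ← ENNReal.ofReal_mul (by norm_num)]
    norm_num
  rw [this, one_mul]

theorem lintegral_cosh_re_inner_gaussianWeight (r : ℝ) (w : EuclideanSpace 𝕜 (Fin n)) :
    ∫⁻ g, ENNReal.ofReal (Real.cosh (r * RCLike.re (inner 𝕜 g w))) ∂(gaussianWeight 𝕜 n) =
      ENNReal.ofReal (Real.exp (r ^ 2 * ‖w‖ ^ 2 / 2)) * gaussianWeight 𝕜 n univ := by
  have key : ∀ s : ℝ, ∫⁻ g, ENNReal.ofReal (Real.exp (s * RCLike.re (inner 𝕜 g w)))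
      ∂(gaussianWeight 𝕜 n) =
      ENNReal.ofReal (Real.exp (s ^ 2 * ‖w‖ ^ 2 / 2)) * gaussianWeight 𝕜 n univ := by
    intro s
    have h := lintegral_exp_re_inner_gaussianWeight ((s : 𝕜) • w)
    rw [norm_smul, RCLike.norm_ofReal, mul_pow, sq_abs] at h
    rw [← h]
    refine lintegral_congr fun g => ?_
    rw [inner_smul_left, RCLike.conj_ofReal, RCLike.re_ofReal_mul, inner_re_symm]
  refine lintegral_cosh_of_lintegral_exp (by fun_prop) (key r) ?_
  rw [← neg_sq r, ← key (-r)]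
  simp_rw [neg_mul]

/-- The even moments of the bilinear form `Re ⟪g, T h⟫` of independent Gaussian vectors. -/
noncomputable def bilinearMoment (T : EuclideanSpace 𝕜 (Fin m) →ₗ[𝕜] EuclideanSpace 𝕜 (Fin n))
    (k : ℕ) : ENNReal :=
  ∫⁻ h, ∫⁻ g, ENNReal.ofReal (RCLike.re (inner 𝕜 g (T h)) ^ (2 * k)) ∂(gaussianWeight 𝕜 n)
    ∂(gaussianWeight 𝕜 m)

theorem measurable_re_inner_apply
    (T : EuclideanSpace 𝕜 (Fin m) →ₗ[𝕜] EuclideanSpace 𝕜 (Fin n)) :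
    Measurable fun q : EuclideanSpace 𝕜 (Fin m) × EuclideanSpace 𝕜 (Fin n) =>
      RCLike.re (inner 𝕜 q.2 (T q.1)) := by
  have hT : Continuous T := T.continuous_of_finiteDimensional
  have : Continuous fun q : EuclideanSpace 𝕜 (Fin m) × EuclideanSpace 𝕜 (Fin n) =>
      RCLike.re (inner 𝕜 q.2 (T q.1)) := by fun_prop
  exact this.measurable

theorem measurable_lintegral_re_inner_pow
    (T : EuclideanSpace 𝕜 (Fin m) →ₗ[𝕜] EuclideanSpace 𝕜 (Fin n)) (k : ℕ) :
    Measurable fun h => ∫⁻ g, ENNReal.ofReal (RCLike.re (inner 𝕜 g (T h)) ^ (2 * k))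
      ∂(gaussianWeight 𝕜 n) :=
  Measurable.lintegral_prod_right'
    (f := fun q : EuclideanSpace 𝕜 (Fin m) × EuclideanSpace 𝕜 (Fin n) =>
      ENNReal.ofReal (RCLike.re (inner 𝕜 q.2 (T q.1)) ^ (2 * k)))
    ((measurable_re_inner_apply T).pow_const _).ennreal_ofReal

/-- The moment generating function of Re⟪g, T h⟫ at √x: integrating out g leaves exp(x‖Th‖²/2), and
integrating out h then gives the product. -/
theorem tsum_bilinearMoment (T : EuclideanSpace 𝕜 (Fin m) →ₗ[𝕜] EuclideanSpace 𝕜 (Fin n))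
    {x : ℝ} (hx0 : 0 ≤ x) (hx : ∀ j : Fin m, T.singularValues j ^ 2 * x < 1) :
    ∑' k : ℕ, ENNReal.ofReal (x ^ k / (2 * k).factorial) * bilinearMoment T k =
      ENNReal.ofReal (∏ j : Fin m, (1 - T.singularValues j ^ 2 * x) ^ (-(betaIndex 𝕜 / 2))) *
        gaussianWeight 𝕜 m univ * gaussianWeight 𝕜 n univ := by
  have hT : Continuous T := T.continuous_of_finiteDimensional
  rw [← lintegral_exp_norm_sq_gaussianWeight T x hx, ← lintegral_mul_const _ (by fun_prop)]
  have h1 : ∀ h, ENNReal.ofReal (Real.exp (x * ‖T h‖ ^ 2 / 2)) * gaussianWeight 𝕜 n univ =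
      ∑' k : ℕ, ENNReal.ofReal (x ^ k / (2 * k).factorial) *
        ∫⁻ g, ENNReal.ofReal (RCLike.re (inner 𝕜 g (T h)) ^ (2 * k))
          ∂(gaussianWeight 𝕜 n) := by
    intro h
    have := lintegral_cosh_re_inner_gaussianWeight (√x) (T h)
    rw [Real.sq_sqrt hx0] at this
    rw [← this]
    simp_rw [ofReal_cosh_eq_tsum, Real.sq_sqrt hx0]
    rw [lintegral_tsum fun k => by fun_prop]
    refine tsum_congr fun k => ?_
    rw [lintegral_const_mul' _ _ ENNReal.ofReal_ne_top]
  rw [lintegral_congr h1, lintegral_tsum fun k =>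
    ((measurable_lintegral_re_inner_pow T k).const_mul _).aemeasurable]
  refine tsum_congr fun k => ?_
  rw [lintegral_const_mul' _ _ ENNReal.ofReal_ne_top, bilinearMoment]

/-- Each moment is bounded through one term of the previous series, evaluated at a point x > 0 small
enough for convergence. -/
theorem bilinearMoment_ne_top [NeZero n] [NeZero m]
    (T : EuclideanSpace 𝕜 (Fin m) →ₗ[𝕜] EuclideanSpace 𝕜 (Fin n)) (k : ℕ) :
    bilinearMoment T k ≠ ⊤ := by
  set S : ℝ := ∑ j : Fin m, T.singularValues j ^ 2
  have hS : 0 ≤ S := Finset.sum_nonneg fun j _ => sq_nonneg _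
  have hx0 : 0 < (1 + S)⁻¹ := by positivity
  have hx : ∀ j : Fin m, T.singularValues j ^ 2 * (1 + S)⁻¹ < 1 := by
    intro j
    rw [← div_eq_mul_inv, div_lt_one (by positivity)]
    have := Finset.single_le_sum (f := fun j : Fin m => T.singularValues j ^ 2)
      (fun j _ => sq_nonneg _) (Finset.mem_univ j)
    linarith
  have h := tsum_bilinearMoment T hx0.le hx
  intro htop
  have h1 := ENNReal.le_tsum (f := fun k : ℕ =>
    ENNReal.ofReal ((1 + S)⁻¹ ^ k / (2 * k).factorial) * bilinearMoment T k) k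
  rw [h, htop, ENNReal.mul_top (by rw [Ne, ENNReal.ofReal_eq_zero, not_le]; positivity)] at h1
  exact (ENNReal.mul_ne_top (ENNReal.mul_ne_top ENNReal.ofReal_ne_top gaussianWeight_univ_ne_top)
    gaussianWeight_univ_ne_top) (top_le_iff.1 h1)

/-- The polar decomposition is applied once to g and once to h, the power of the form being
homogeneous of degree 2k in each. -/
theorem lintegral_unitary_bilinear_pow [NeZero n] [NeZero m]
    (T : EuclideanSpace 𝕜 (Fin m) →ₗ[𝕜] EuclideanSpace 𝕜 (Fin n))
    (νU : Measure (Matrix.unitaryGroup (Fin n) 𝕜)) [IsProbabilityMeasure νU]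
    [νU.IsMulRightInvariant]
    (νV : Measure (Matrix.unitaryGroup (Fin m) 𝕜)) [IsProbabilityMeasure νV]
    [νV.IsMulRightInvariant] (i : Fin m) (j : Fin n) (k : ℕ) :
    (∫⁻ V, ∫⁻ U, ENNReal.ofReal (RCLike.re (inner 𝕜
        (Matrix.toEuclideanLin (U : Matrix (Fin n) (Fin n) 𝕜) (EuclideanSpace.single j (1 : 𝕜)))
        (T (Matrix.toEuclideanLin (V : Matrix (Fin m) (Fin m) 𝕜)
          (EuclideanSpace.single i (1 : 𝕜))))) ^ (2 * k)) ∂νU ∂νV) *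
      (∫⁻ v, ENNReal.ofReal ‖v‖ ^ (2 * k) ∂(gaussianWeight 𝕜 n)) *
      (∫⁻ v, ENNReal.ofReal ‖v‖ ^ (2 * k) ∂(gaussianWeight 𝕜 m)) = bilinearMoment T k := by
  have hT : Continuous T := T.continuous_of_finiteDimensional
  have hfin : ∫⁻ v, ENNReal.ofReal ‖v‖ ^ (2 * k) ∂(gaussianWeight 𝕜 n) ≠ ⊤ := by
    rw [lintegral_norm_pow_gaussianWeight]
    exact ENNReal.mul_ne_top ENNReal.ofReal_ne_top gaussianWeight_univ_ne_top
  have h1 : ∀ h, (∫⁻ U, ENNReal.ofReal (RCLike.re (inner 𝕜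
        (Matrix.toEuclideanLin (U : Matrix (Fin n) (Fin n) 𝕜) (EuclideanSpace.single j (1 : 𝕜)))
        (T h)) ^ (2 * k)) ∂νU) *
      (∫⁻ v, ENNReal.ofReal ‖v‖ ^ (2 * k) ∂(gaussianWeight 𝕜 n)) =
      ∫⁻ g, ENNReal.ofReal (RCLike.re (inner 𝕜 g (T h)) ^ (2 * k)) ∂(gaussianWeight 𝕜 n) := by
    intro h
    refine lintegral_unitary_mul_lintegral_norm_pow νU j (2 * k)
      (f := fun g => ENNReal.ofReal (RCLike.re (inner 𝕜 g (T h)) ^ (2 * k))) (by fun_prop) ?_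
    intro c v hc
    rw [RCLike.real_smul_eq_coe_smul (K := 𝕜), inner_smul_left, RCLike.conj_ofReal,
      RCLike.re_ofReal_mul, mul_pow, ENNReal.ofReal_mul (by positivity), ENNReal.ofReal_pow hc]
  rw [← lintegral_mul_const' _ _ hfin, lintegral_congr fun V => h1 _]
  refine lintegral_unitary_mul_lintegral_norm_pow νV i (2 * k)
    (measurable_lintegral_re_inner_pow T k) ?_
  intro c v hc
  rw [← lintegral_const_mul' _ _ (by finiteness)]
  refine lintegral_congr fun g => ?_
  rw [RCLike.real_smul_eq_coe_smul (K := 𝕜), map_smul, inner_smul_right,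
    RCLike.re_ofReal_mul, mul_pow, ENNReal.ofReal_mul (by positivity), ENNReal.ofReal_pow hc]

theorem measurable_unitary_apply (v : EuclideanSpace 𝕜 (Fin n)) :
    Measurable fun U : Matrix.unitaryGroup (Fin n) 𝕜 =>
      Matrix.toEuclideanLin (U : Matrix (Fin n) (Fin n) 𝕜) v :=
  Measurable.comp (g := fun q : Matrix.unitaryGroup (Fin n) 𝕜 × EuclideanSpace 𝕜 (Fin n) =>
    Matrix.toEuclideanLin (q.1 : Matrix (Fin n) (Fin n) 𝕜) q.2)
    (f := fun U => (U, v)) measurable_toEuclideanLin_unitary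
    (measurable_id.prodMk measurable_const)

theorem measurable_bilinear_unitary
    (T : EuclideanSpace 𝕜 (Fin m) →ₗ[𝕜] EuclideanSpace 𝕜 (Fin n)) (i : Fin m) (j : Fin n) :
    Measurable fun q : Matrix.unitaryGroup (Fin m) 𝕜 × Matrix.unitaryGroup (Fin n) 𝕜 =>
      RCLike.re (inner 𝕜
        (Matrix.toEuclideanLin (q.2 : Matrix (Fin n) (Fin n) 𝕜) (EuclideanSpace.single j (1 : 𝕜)))
        (T (Matrix.toEuclideanLin (q.1 : Matrix (Fin m) (Fin m) 𝕜)
          (EuclideanSpace.single i (1 : 𝕜))))) := by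
  have hfst : Measurable (Prod.fst : Matrix.unitaryGroup (Fin m) 𝕜 ×
      Matrix.unitaryGroup (Fin n) 𝕜 → Matrix.unitaryGroup (Fin m) 𝕜) := measurable_fst
  have hsnd : Measurable (Prod.snd : Matrix.unitaryGroup (Fin m) 𝕜 ×
      Matrix.unitaryGroup (Fin n) 𝕜 → Matrix.unitaryGroup (Fin n) 𝕜) := measurable_snd
  have h1 := (measurable_unitary_apply (EuclideanSpace.single i (1 : 𝕜))).comp hfst
  have h2 := (measurable_unitary_apply (EuclideanSpace.single j (1 : 𝕜))).comp hsnd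
  have h3 := (measurable_re_inner_apply T).comp (Measurable.prodMk h1 h2)
  exact h3

theorem lintegral_exp_eq_tsum_of_neg {α γ : Type*} [MeasurableSpace α] [MeasurableSpace γ]
    {μ : Measure α} {ν : Measure γ} [SFinite ν] {X : α → γ → ℝ}
    (hX : Measurable fun q : α × γ => X q.1 q.2) (r : ℝ)
    (hneg : ∀ a, ∫⁻ c, ENNReal.ofReal (Real.exp (-(r * X a c))) ∂ν =
      ∫⁻ c, ENNReal.ofReal (Real.exp (r * X a c)) ∂ν) :
    ∫⁻ a, ∫⁻ c, ENNReal.ofReal (Real.exp (r * X a c)) ∂ν ∂μ =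
    ∑' k : ℕ, ENNReal.ofReal ((r ^ 2) ^ k / (2 * k).factorial) *
      ∫⁻ a, ∫⁻ c, ENNReal.ofReal (X a c ^ (2 * k)) ∂ν ∂μ := by
  have hXV : ∀ V, Measurable (X V) := fun V => hX.comp (measurable_const.prodMk measurable_id)
  have hcosh : ∀ V, ∫⁻ U, ENNReal.ofReal (Real.exp (r * X V U)) ∂ν =
      ∑' k : ℕ, ENNReal.ofReal ((r ^ 2) ^ k / (2 * k).factorial) *
        ∫⁻ U, ENNReal.ofReal (X V U ^ (2 * k)) ∂ν := by
    intro V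
    rw [← lintegral_cosh_of_lintegral_exp ((hXV V).const_mul r) rfl (hneg V)]
    simp_rw [ofReal_cosh_eq_tsum]
    rw [lintegral_tsum fun k =>
      (((hXV V).pow_const _).ennreal_ofReal.const_mul _).aemeasurable]
    refine tsum_congr fun k => ?_
    rw [lintegral_const_mul' _ _ ENNReal.ofReal_ne_top]
  have hm2 : ∀ k : ℕ, Measurable fun V => ∫⁻ U, ENNReal.ofReal (X V U ^ (2 * k)) ∂ν :=
    fun k => Measurable.lintegral_prod_right' (hX.pow_const (2 * k)).ennreal_ofReal
  rw [lintegral_congr hcosh, lintegral_tsum fun k => ((hm2 k).const_mul _).aemeasurable]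
  refine tsum_congr fun k => ?_
  rw [lintegral_const_mul' _ _ ENNReal.ofReal_ne_top]

/-- Translating U by -1 changes the sign of the form, so only even powers survive. -/
theorem lintegral_exp_bilinear_unitary
    (T : EuclideanSpace 𝕜 (Fin m) →ₗ[𝕜] EuclideanSpace 𝕜 (Fin n))
    (νU : Measure (Matrix.unitaryGroup (Fin n) 𝕜)) [IsProbabilityMeasure νU]
    [νU.IsMulRightInvariant]
    (νV : Measure (Matrix.unitaryGroup (Fin m) 𝕜)) [IsProbabilityMeasure νV]
    (i : Fin m) (j : Fin n) (r : ℝ) :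
    ∫⁻ V, ∫⁻ U, ENNReal.ofReal (Real.exp (r * RCLike.re (inner 𝕜
        (Matrix.toEuclideanLin (U : Matrix (Fin n) (Fin n) 𝕜) (EuclideanSpace.single j (1 : 𝕜)))
        (T (Matrix.toEuclideanLin (V : Matrix (Fin m) (Fin m) 𝕜)
          (EuclideanSpace.single i (1 : 𝕜))))))) ∂νU ∂νV =
    ∑' k : ℕ, ENNReal.ofReal ((r ^ 2) ^ k / (2 * k).factorial) *
      ∫⁻ V, ∫⁻ U, ENNReal.ofReal (RCLike.re (inner 𝕜
        (Matrix.toEuclideanLin (U : Matrix (Fin n) (Fin n) 𝕜) (EuclideanSpace.single j (1 : 𝕜)))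
        (T (Matrix.toEuclideanLin (V : Matrix (Fin m) (Fin m) 𝕜)
          (EuclideanSpace.single i (1 : 𝕜))))) ^ (2 * k)) ∂νU ∂νV := by
  refine lintegral_exp_eq_tsum_of_neg (measurable_bilinear_unitary T i j) r fun V => ?_
  have hN : (-1 : Matrix (Fin n) (Fin n) 𝕜) ∈ Matrix.unitaryGroup (Fin n) 𝕜 := by
    rw [Matrix.mem_unitaryGroup_iff]; simp
  generalize T (Matrix.toEuclideanLin (V : Matrix (Fin m) (Fin m) 𝕜)
    (EuclideanSpace.single i (1 : 𝕜))) = w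
  rw [← lintegral_mul_right_eq_self (μ := νU)
    (fun U : Matrix.unitaryGroup (Fin n) 𝕜 => ENNReal.ofReal (Real.exp (r * RCLike.re (inner 𝕜
      (Matrix.toEuclideanLin (U : Matrix (Fin n) (Fin n) 𝕜)
        (EuclideanSpace.single j (1 : 𝕜))) w)))) ⟨-1, hN⟩]
  refine lintegral_congr fun U => ?_
  rw [Submonoid.coe_mul, mul_neg_one, map_neg, LinearMap.neg_apply, inner_neg_left, map_neg,
    mul_neg]

end Expansion

/-! ### The exact power series of the spherical expectation -/

section RealExpansion

variable {𝕜 : Type*} [RCLike 𝕜] {n m : ℕ}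

/-- The coefficients of the power series of `x ↦ ∏ⱼ (1 - sⱼ² x) ^ (-β/2)`. -/
noncomputable def singularCoeff (M : Matrix (Fin n) (Fin m) 𝕜) (k : ℕ) : ℝ :=
  (bilinearMoment (Matrix.toEuclideanLin M) k).toReal /
    ((2 * k).factorial * ((gaussianWeight 𝕜 m univ).toReal * (gaussianWeight 𝕜 n univ).toReal))

theorem singularCoeff_nonneg (M : Matrix (Fin n) (Fin m) 𝕜) (k : ℕ) : 0 ≤ singularCoeff M k := by
  unfold singularCoeff; positivity

theorem gaussianWeight_univ_toReal_pos [NeZero n] : 0 < (gaussianWeight 𝕜 n univ).toReal :=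
  ENNReal.toReal_pos gaussianWeight_univ_ne_zero gaussianWeight_univ_ne_top

theorem singularValues_toEuclideanLin_eq_zero (M : Matrix (Fin n) (Fin m) 𝕜) {j : ℕ}
    (hj : n ≤ j) : (Matrix.toEuclideanLin M).singularValues j = 0 := by
  rw [LinearMap.singularValues_eq_zero_iff_le_finrank_range]
  refine (Submodule.finrank_le _).trans ?_
  simpa using hj

theorem prod_singularValues_eq (hnm : n ≤ m) (M : Matrix (Fin n) (Fin m) 𝕜) (f : ℝ → ℝ)
    (hf : f 0 = 1) :
    ∏ j : Fin m, f ((Matrix.toEuclideanLin M).singularValues j) =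
      ∏ j : Fin n, f (singularValue M j) := by
  unfold singularValue
  rw [Fin.prod_univ_eq_prod_range (fun j => f ((Matrix.toEuclideanLin M).singularValues j)),
    Fin.prod_univ_eq_prod_range (fun j => f ((Matrix.toEuclideanLin M).singularValues j))]
  refine (Finset.prod_subset (Finset.range_mono hnm) fun j _ hj => ?_).symm
  rw [singularValues_toEuclideanLin_eq_zero M (by simpa using hj), hf]

/-- Normalized, real-valued form of `tsum_bilinearMoment`. The m - n further singular values of M as
a map from 𝕜ᵐ vanish and contribute factors 1. -/
theorem hasSum_singularCoeff [NeZero n] [NeZero m] (hnm : n ≤ m) (M : Matrix (Fin n) (Fin m) 𝕜)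
    {x : ℝ} (hx0 : 0 ≤ x) (hx : ∀ j : Fin n, singularValue M j ^ 2 * x < 1) :
    HasSum (fun k => singularCoeff M k * x ^ k)
      (∏ j : Fin n, (1 - singularValue M j ^ 2 * x) ^ (-(betaIndex 𝕜 / 2))) := by
  have hx' : ∀ j : Fin m, (Matrix.toEuclideanLin M).singularValues j ^ 2 * x < 1 := by
    intro j
    by_cases hj : (j : ℕ) < n
    · exact hx ⟨j, hj⟩
    · rw [singularValues_toEuclideanLin_eq_zero M (not_lt.1 hj)]; norm_num
  have h := tsum_bilinearMoment (Matrix.toEuclideanLin M) hx0 hx'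
  have hprod := prod_singularValues_eq hnm M
    (fun s => (1 - s ^ 2 * x) ^ (-(betaIndex 𝕜 / 2))) (by simp)
  have hZm := gaussianWeight_univ_toReal_pos (𝕜 := 𝕜) (n := m)
  have hZn := gaussianWeight_univ_toReal_pos (𝕜 := 𝕜) (n := n)
  rw [hprod] at h
  have hpos : 0 ≤ ∏ j : Fin n, (1 - singularValue M j ^ 2 * x) ^ (-(betaIndex 𝕜 / 2)) :=
    Finset.prod_nonneg fun j _ => Real.rpow_nonneg (by linarith [hx j]) _
  have hterm : ∀ k : ℕ, ENNReal.ofReal (x ^ k / (2 * k).factorial) *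
      bilinearMoment (Matrix.toEuclideanLin M) k = ENNReal.ofReal (singularCoeff M k * x ^ k) *
        (gaussianWeight 𝕜 m univ * gaussianWeight 𝕜 n univ) := by
    intro k
    rw [← ENNReal.toReal_eq_toReal_iff' (by
        exact ENNReal.mul_ne_top ENNReal.ofReal_ne_top (bilinearMoment_ne_top _ _))
        (ENNReal.mul_ne_top ENNReal.ofReal_ne_top
          (ENNReal.mul_ne_top gaussianWeight_univ_ne_top gaussianWeight_univ_ne_top))]
    simp only [ENNReal.toReal_mul]
    rw [ENNReal.toReal_ofReal (by positivity), ENNReal.toReal_ofReal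
      (mul_nonneg (singularCoeff_nonneg M k) (by positivity)), singularCoeff]
    field_simp
  simp_rw [hterm, ENNReal.tsum_mul_right, mul_assoc] at h
  have h2 : ∑' k, ENNReal.ofReal (singularCoeff M k * x ^ k) = ENNReal.ofReal
      (∏ j : Fin n, (1 - singularValue M j ^ 2 * x) ^ (-(betaIndex 𝕜 / 2))) := by
    refine (ENNReal.mul_left_inj ?_ ?_).1 h
    · exact mul_ne_zero gaussianWeight_univ_ne_zero gaussianWeight_univ_ne_zero
    · exact ENNReal.mul_ne_top gaussianWeight_univ_ne_top gaussianWeight_univ_ne_top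
  have hnn : ∀ k, 0 ≤ singularCoeff M k * x ^ k := fun k =>
    mul_nonneg (singularCoeff_nonneg M k) (by positivity)
  have hs : Summable fun k => singularCoeff M k * x ^ k := by
    have := ENNReal.summable_toReal (h2.trans_ne ENNReal.ofReal_ne_top)
    simpa [ENNReal.toReal_ofReal (hnn _)] using this
  rw [← ENNReal.ofReal_tsum_of_nonneg hnn hs,
    ENNReal.ofReal_eq_ofReal_iff (tsum_nonneg hnn) hpos] at h2
  rw [← h2]
  exact hs.hasSum

theorem trace_elementary_eq_inner (i : Fin m) (j : Fin n) (U : Matrix.unitaryGroup (Fin n) 𝕜)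
    (M : Matrix (Fin n) (Fin m) 𝕜) (V : Matrix.unitaryGroup (Fin m) 𝕜) :
    Matrix.trace (Matrix.single i j (1 : 𝕜) * (U : Matrix (Fin n) (Fin n) 𝕜) * M *
      (V : Matrix (Fin m) (Fin m) 𝕜)) =
    inner 𝕜 (Matrix.toEuclideanLin ((U⁻¹ : Matrix.unitaryGroup (Fin n) 𝕜) :
        Matrix (Fin n) (Fin n) 𝕜) (EuclideanSpace.single j (1 : 𝕜)))
      (Matrix.toEuclideanLin M (Matrix.toEuclideanLin (V : Matrix (Fin m) (Fin m) 𝕜)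
        (EuclideanSpace.single i (1 : 𝕜)))) := by
  have hU : ((U⁻¹ : Matrix.unitaryGroup (Fin n) 𝕜) : Matrix (Fin n) (Fin n) 𝕜).conjTranspose =
      (U : Matrix (Fin n) (Fin n) 𝕜) := by
    change ((U : Matrix (Fin n) (Fin n) 𝕜).conjTranspose).conjTranspose = _
    simp
  rw [inner_toEuclideanLin_left, hU, ← toEuclideanLin_mul_apply, ← toEuclideanLin_mul_apply,
    Matrix.mul_assoc, Matrix.mul_assoc, Matrix.trace_single_mul]
  simp [EuclideanSpace.inner_single_left, Matrix.mul_apply, Matrix.mulVec,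
    dotProduct]

/-- The origin of T in the problem: its values at i/N are the successive factors of the product of
the two Gaussian radial moments, rescaled. -/
theorem rectT_ratio_eq {b : ℝ} (hb : 0 < b) [NeZero n] [NeZero m] (i : ℕ) :
    rectT ((n : ℝ) / m) (i / (b * n / 2)) =
      (b * n / 2 + i) * (b * m / 2 + i) / (b ^ 2 * (n * m) / 4) := by
  have hn : (n : ℝ) ≠ 0 := Nat.cast_ne_zero.2 (NeZero.ne n)
  have hm : (m : ℝ) ≠ 0 := Nat.cast_ne_zero.2 (NeZero.ne m)
  unfold rectT
  field_simp
  ring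

theorem integral_exp_trace_eq_tsum [NeZero n] [NeZero m]
    (M : Matrix (Fin n) (Fin m) 𝕜) {Ω : Type*} [MeasurableSpace Ω] (P : Measure Ω)
    [IsProbabilityMeasure P] {U : Ω → Matrix.unitaryGroup (Fin n) 𝕜}
    {V : Ω → Matrix.unitaryGroup (Fin m) 𝕜} (hU : IsHaarDistributed P U)
    (hV : IsHaarDistributed P V) (hUV : IndepFun U V P) {E : Matrix (Fin m) (Fin n) 𝕜}
    (hE : IsElementary E) (θ : ℝ) :
    ∫ ω, Real.exp (√((n : ℝ) * (m : ℝ)) * θ *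
      RCLike.re (Matrix.trace (E * (U ω : Matrix (Fin n) (Fin n) 𝕜) * M *
        (V ω : Matrix (Fin m) (Fin m) 𝕜)))) ∂P =
    ∑' k : ℕ, singularCoeff M k * ((θ / betaIndex 𝕜) ^ 2) ^ k /
      ∏ i ∈ Finset.range k, rectT ((n : ℝ) / m) (i / (betaIndex 𝕜 * n / 2)) := by
  obtain ⟨i, j, rfl⟩ := hE
  obtain ⟨hUm, hUH⟩ := hU
  obtain ⟨hVm, hVH⟩ := hV
  have hb := betaIndex_pos (𝕜 := 𝕜)
  have hn : (n : ℝ) ≠ 0 := Nat.cast_ne_zero.2 (NeZero.ne n)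
  have hm : (m : ℝ) ≠ 0 := Nat.cast_ne_zero.2 (NeZero.ne m)
  have hPU : IsProbabilityMeasure (P.map U) := Measure.isProbabilityMeasure_map hUm.aemeasurable
  have hPV : IsProbabilityMeasure (P.map V) := Measure.isProbabilityMeasure_map hVm.aemeasurable
  have hinv : Measurable fun W : Matrix.unitaryGroup (Fin n) 𝕜 => W⁻¹ :=
    continuous_inv.measurable
  -- U enters through U⁻¹, whose law is right invariant because that of U is left invariant; for V
  -- the uniqueness of Haar measure is needed.
  have hVright := isMulRightInvariant_of_isHaarMeasure (P.map V)
  have hPUi : IsProbabilityMeasure (P.map U).inv :=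
    Measure.isProbabilityMeasure_map hinv.aemeasurable
  set T := Matrix.toEuclideanLin M with hTdef
  set r := √((n : ℝ) * (m : ℝ)) * θ with hr
  have hr2 : r ^ 2 = n * m * θ ^ 2 := by
    rw [hr, mul_pow, Real.sq_sqrt (by positivity)]
  set X : Matrix.unitaryGroup (Fin m) 𝕜 × Matrix.unitaryGroup (Fin n) 𝕜 → ℝ := fun q =>
    RCLike.re (inner 𝕜
        (Matrix.toEuclideanLin (q.2 : Matrix (Fin n) (Fin n) 𝕜) (EuclideanSpace.single j (1 : 𝕜)))
        (T (Matrix.toEuclideanLin (q.1 : Matrix (Fin m) (Fin m) 𝕜)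
          (EuclideanSpace.single i (1 : 𝕜))))) with hXdef
  have hX : Measurable X := measurable_bilinear_unitary T i j
  have hUinv : Measurable fun ω => (U ω)⁻¹ := hinv.comp hUm
  have hlaw : P.map (fun ω => (V ω, (U ω)⁻¹)) = (P.map V).prod (P.map U).inv := by
    have h1 : IndepFun V (fun ω => (U ω)⁻¹) P := hUV.symm.comp measurable_id hinv
    rw [(indepFun_iff_map_prod_eq_prod_map_map hVm.aemeasurable
      hUinv.aemeasurable).1 h1, Measure.inv, Measure.map_map hinv hUm]
    rfl
  set w : ℕ → ENNReal := fun k => ∫⁻ W, ∫⁻ W', ENNReal.ofReal (X (W, W') ^ (2 * k))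
    ∂(P.map U).inv ∂(P.map V) with hw
  have hlin : ∫⁻ ω, ENNReal.ofReal (Real.exp (r * X (V ω, (U ω)⁻¹))) ∂P =
      ∑' k : ℕ, ENNReal.ofReal ((r ^ 2) ^ k / (2 * k).factorial) * w k := by
    have h2 := lintegral_exp_bilinear_unitary T (P.map U).inv (P.map V) i j r
    refine Eq.trans ?_ h2
    have hmX : Measurable fun q => ENNReal.ofReal (Real.exp (r * X q)) := by fun_prop
    rw [← lintegral_map (f := fun q => ENNReal.ofReal (Real.exp (r * X q))) hmX
      (hVm.prodMk hUinv), hlaw, lintegral_prod _ hmX.aemeasurable]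
  have hwk : ∀ k, w k * (∫⁻ v, ENNReal.ofReal ‖v‖ ^ (2 * k) ∂(gaussianWeight 𝕜 n)) *
      (∫⁻ v, ENNReal.ofReal ‖v‖ ^ (2 * k) ∂(gaussianWeight 𝕜 m)) = bilinearMoment T k :=
    fun k => lintegral_unitary_bilinear_pow T (P.map U).inv (P.map V) i j k
  have hZm := gaussianWeight_univ_toReal_pos (𝕜 := 𝕜) (n := m)
  have hZn := gaussianWeight_univ_toReal_pos (𝕜 := 𝕜) (n := n)
  have hterm : ∀ k : ℕ, ENNReal.toReal (ENNReal.ofReal ((r ^ 2) ^ k / (2 * k).factorial) * w k) =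
      singularCoeff M k * ((θ / betaIndex 𝕜) ^ 2) ^ k /
        ∏ i ∈ Finset.range k, rectT ((n : ℝ) / m) (i / (betaIndex 𝕜 * n / 2)) := by
    intro k
    have h3 := congrArg ENNReal.toReal (hwk k)
    rw [lintegral_norm_pow_gaussianWeight, lintegral_norm_pow_gaussianWeight] at h3
    simp only [ENNReal.toReal_mul] at h3
    rw [ENNReal.toReal_ofReal (by positivity), ENNReal.toReal_ofReal (by positivity)] at h3
    rw [ENNReal.toReal_mul, ENNReal.toReal_ofReal (by positivity), singularCoeff, ← h3, hr2]
    simp_rw [rectT_ratio_eq hb]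
    simp only [Finset.prod_div_distrib, Finset.prod_mul_distrib, Finset.prod_const,
      Finset.card_range]
    have hp1 : ∏ i ∈ Finset.range k, (betaIndex 𝕜 * n / 2 + (i : ℝ)) ≠ 0 :=
      Finset.prod_ne_zero_iff.2 fun i _ => by positivity
    have hp2 : ∏ i ∈ Finset.range k, (betaIndex 𝕜 * m / 2 + (i : ℝ)) ≠ 0 :=
      Finset.prod_ne_zero_iff.2 fun i _ => by positivity
    have h16 : (4 : ℝ) ^ k = 2 ^ k * 2 ^ k := by rw [← mul_pow]; norm_num
    simp only [div_pow, mul_pow, h16]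
    field_simp
  -- An infinite w k, multiplied by nonzero radial moments, would make the Gaussian moment infinite.
  have hwtop : ∀ k, ENNReal.ofReal ((r ^ 2) ^ k / (2 * k).factorial) * w k ≠ ⊤ := by
    intro k
    refine ENNReal.mul_ne_top ENNReal.ofReal_ne_top fun htop => ?_
    have h4 := hwk k
    have hpos : ∀ (d : ℕ) [NeZero d],
        ∫⁻ v, ENNReal.ofReal ‖v‖ ^ (2 * k) ∂(gaussianWeight 𝕜 d) ≠ 0 := by
      intro d _
      have hd : (d : ℝ) ≠ 0 := Nat.cast_ne_zero.2 (NeZero.ne d)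
      rw [lintegral_norm_pow_gaussianWeight]
      refine mul_ne_zero ?_ gaussianWeight_univ_ne_zero
      rw [Ne, ENNReal.ofReal_eq_zero, not_le]
      refine mul_pos (by positivity) (Finset.prod_pos fun i _ => ?_)
      positivity
    rw [htop, ENNReal.top_mul (hpos n), ENNReal.top_mul (hpos m)] at h4
    exact bilinearMoment_ne_top T k h4.symm
  simp_rw [trace_elementary_eq_inner]
  rw [integral_eq_lintegral_of_nonneg_ae (ae_of_all _ fun ω => by positivity)
    (by
      have : Measurable fun ω => Real.exp (r * X (V ω, (U ω)⁻¹)) := by fun_prop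
      exact this.aestronglyMeasurable)]
  refine (congrArg ENNReal.toReal hlin).trans ?_
  rw [ENNReal.tsum_toReal_eq hwtop]
  exact tsum_congr hterm

end RealExpansion

/-! ### Laplace asymptotics of weighted power series -/

section Asymptotics

theorem one_add_le_rectT {l z : ℝ} (hl : 0 ≤ l) (hz : 0 ≤ z) : 1 + z ≤ rectT l z := by
  unfold rectT
  nlinarith [mul_nonneg hl hz, mul_nonneg (mul_nonneg hl hz) hz]

theorem one_le_rectT {l z : ℝ} (hl : 0 ≤ l) (hz : 0 ≤ z) : 1 ≤ rectT l z := by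
  linarith [one_add_le_rectT hl hz]

theorem rectT_mono {l : ℝ} (hl : 0 ≤ l) {z z' : ℝ} (hz : 0 ≤ z) (h : z ≤ z') :
    rectT l z ≤ rectT l z' := by
  unfold rectT
  have := mul_le_mul_of_nonneg_left h hl
  have := mul_nonneg hl hz
  have : 0 ≤ l * z' + 1 := by linarith
  gcongr

theorem continuous_rectT (l : ℝ) : Continuous (rectT l) := by
  unfold rectT; fun_prop

/-- The factor z + 1 cancels, and log r ≤ r - 1 handles the ratio of the other factors. -/
theorem abs_log_rectT_sub_le {l l' z : ℝ} (hl : 0 ≤ l) (hl' : 0 ≤ l') (hz : 0 ≤ z) :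
    |Real.log (rectT l z) - Real.log (rectT l' z)| ≤ |l - l'| * z := by
  have aux : ∀ a b : ℝ, 0 ≤ a → 0 ≤ b →
      Real.log (rectT a z) - Real.log (rectT b z) ≤ |a - b| * z := by
    intro a b ha hb
    have hb1 : 1 ≤ b * z + 1 := by linarith [mul_nonneg hb hz]
    have ha1 : 1 ≤ a * z + 1 := by linarith [mul_nonneg ha hz]
    unfold rectT
    rw [Real.log_mul (by positivity) (by positivity), Real.log_mul (by positivity) (by positivity)]
    have h1 := Real.log_le_sub_one_of_pos (x := (a * z + 1) / (b * z + 1)) (by positivity)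
    rw [Real.log_div (by positivity) (by positivity)] at h1
    have h2 : (a * z + 1) / (b * z + 1) - 1 = (a - b) * z / (b * z + 1) := by
      field_simp
      ring
    have h3 : (a - b) * z / (b * z + 1) ≤ |a - b| * z := by
      rw [div_le_iff₀ (by positivity)]
      have := mul_le_mul_of_nonneg_right (le_abs_self (a - b)) hz
      nlinarith [mul_nonneg (abs_nonneg (a - b)) hz]
    linarith
  rw [abs_le]
  have h1 := aux l l' hl hl'
  have h2 := aux l' l hl' hl
  rw [abs_sub_comm] at h2
  constructor <;> linarith

theorem continuousOn_log_rectT {l : ℝ} (hl : 0 ≤ l) :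
    ContinuousOn (fun z => Real.log (rectT l z)) (Ici 0) :=
  (continuous_rectT l).continuousOn.log fun _ hz =>
    (zero_lt_one.trans_le (one_le_rectT hl hz)).ne'

theorem antitoneOn_sub_log_rectT {l : ℝ} (hl : 0 ≤ l) (c : ℝ) :
    AntitoneOn (fun z => c - Real.log (rectT l z)) (Ici 0) := by
  intro z hz z' _ h
  have := Real.log_le_log (zero_lt_one.trans_le (one_le_rectT hl hz)) (rectT_mono hl hz h)
  simp only
  linarith

theorem intervalIntegrable_sub_log_rectT {l : ℝ} (hl : 0 ≤ l) (c : ℝ) {u v : ℝ} (hu : 0 ≤ u)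
    (hv : 0 ≤ v) : IntervalIntegrable (fun z => c - Real.log (rectT l z)) volume u v :=
  (continuousOn_const.sub ((continuousOn_log_rectT hl).mono fun _ hz =>
    (le_inf hu hv).trans hz.1)).intervalIntegrable

theorem integral_le_sum_div {g : ℝ → ℝ} (hg : AntitoneOn g (Ici 0)) {N : ℝ} (hN : 0 < N) (k : ℕ) :
    N * ∫ z in (0 : ℝ)..(k / N), g z ≤ ∑ i ∈ Finset.range k, g (i / N) := by
  have h : AntitoneOn (fun z => g (z / N)) (Icc 0 (0 + (k : ℝ))) := by
    intro z hz z' hz' hzz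
    exact hg (div_nonneg hz.1 hN.le) (div_nonneg hz'.1 hN.le) (by gcongr)
  have := h.integral_le_sum
  rw [intervalIntegral.integral_comp_div _ hN.ne'] at this
  simpa using this

theorem sum_div_le_integral {g : ℝ → ℝ} (hg : AntitoneOn g (Ici 0)) {N : ℝ} (hN : 0 < N) (k : ℕ) :
    ∑ i ∈ Finset.range (k + 1), g (i / N) ≤ g 0 + N * ∫ z in (0 : ℝ)..(k / N), g z := by
  have h : AntitoneOn (fun z => g (z / N)) (Icc 0 (0 + (k : ℝ))) := by
    intro z hz z' hz' hzz
    exact hg (div_nonneg hz.1 hN.le) (div_nonneg hz'.1 hN.le) (by gcongr)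
  have := h.sum_le_integral
  rw [intervalIntegral.integral_comp_div _ hN.ne'] at this
  rw [Finset.sum_range_succ']
  simp only [zero_add, zero_div, smul_eq_mul] at this
  simp only [Nat.cast_zero, zero_div]
  linarith

/-- The integral `∫₀ᵏ (log T(k) - log T(z)) dz` for `T = rectT l`. -/
noncomputable def rectEntropy (l k : ℝ) : ℝ :=
  ∫ z in (0 : ℝ)..k, (Real.log (rectT l k) - Real.log (rectT l z))

/-- The integrand is nonnegative before κ and nonpositive after it, so the integral is largest at u
= κ. -/
theorem integral_sub_log_rectT_le {l κ u : ℝ} (hl : 0 ≤ l) (hκ : 0 ≤ κ) (hu : 0 ≤ u) :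
    ∫ z in (0 : ℝ)..u, (Real.log (rectT l κ) - Real.log (rectT l z)) ≤ rectEntropy l κ := by
  rw [rectEntropy, ← intervalIntegral.integral_add_adjacent_intervals
    (intervalIntegrable_sub_log_rectT hl _ le_rfl hκ)
    (intervalIntegrable_sub_log_rectT hl _ hκ hu)]
  have hanti := antitoneOn_sub_log_rectT hl (Real.log (rectT l κ))
  rcases le_total κ u with h | h
  · have : ∫ z in κ..u, (Real.log (rectT l κ) - Real.log (rectT l z)) ≤ ∫ z in κ..u, (0 : ℝ) := by
      refine intervalIntegral.integral_mono_on h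
        (intervalIntegrable_sub_log_rectT hl _ hκ hu) intervalIntegrable_const fun z hz => ?_
      have := hanti (mem_Ici.2 hκ) (mem_Ici.2 (hκ.trans hz.1)) hz.1
      simpa using this
    simp only [intervalIntegral.integral_zero] at this
    linarith
  · rw [intervalIntegral.integral_symm u κ]
    have : 0 ≤ ∫ z in u..κ, (Real.log (rectT l κ) - Real.log (rectT l z)) := by
      refine intervalIntegral.integral_nonneg h fun z hz => ?_
      have := hanti (mem_Ici.2 (hu.trans hz.1)) (mem_Ici.2 hκ) hz.2
      simpa using this
    linarith

/-- On [0, κ + 1] both logarithms lie between 0 and log T(κ + 1), which bounds the part of the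
integral between κ and u. -/
theorem rectEntropy_sub_le_integral {l κ u : ℝ} (hl : 0 ≤ l) (hκ : 0 ≤ κ) (hu : 0 ≤ u)
    (huκ : u ≤ κ + 1) :
    rectEntropy l κ - Real.log (rectT l (κ + 1)) * |u - κ| ≤
      ∫ z in (0 : ℝ)..u, (Real.log (rectT l κ) - Real.log (rectT l z)) := by
  rw [rectEntropy, ← intervalIntegral.integral_add_adjacent_intervals
    (intervalIntegrable_sub_log_rectT hl _ le_rfl hκ)
    (intervalIntegrable_sub_log_rectT hl _ hκ hu)]
  have h := intervalIntegral.norm_integral_le_of_norm_le_const (a := κ) (b := u)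
    (f := fun z => Real.log (rectT l κ) - Real.log (rectT l z))
    (C := Real.log (rectT l (κ + 1))) fun z hz => by
      have hz0 : 0 ≤ z := (le_inf hκ hu).trans hz.1.le
      have hz1 : z ≤ κ + 1 := hz.2.trans (sup_le (by linarith) huκ)
      have h1 := Real.log_le_log (zero_lt_one.trans_le (one_le_rectT hl hz0))
        (rectT_mono hl hz0 hz1)
      have h2 := Real.log_le_log (zero_lt_one.trans_le (one_le_rectT hl hκ))
        (rectT_mono hl hκ (by linarith : κ ≤ κ + 1))
      have h3 := Real.log_nonneg (one_le_rectT hl hz0)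
      have h4 := Real.log_nonneg (one_le_rectT hl hκ)
      rw [Real.norm_eq_abs, abs_le]
      constructor <;> linarith
  rw [Real.norm_eq_abs, abs_le] at h
  linarith [h.1]

/-- Uniformity in u is the point, since k/N is unbounded in the series. The error |l' - l| z is only
paid up to z = T_l(κ); beyond it T_{l'}(z) ≥ 1 + z > T_l(κ), so the integrand is negative. -/
theorem integral_sub_log_rectT_perturb_le {l l' κ u : ℝ} (hl : 0 ≤ l) (hl' : 0 ≤ l')
    (hκ : 0 ≤ κ) (hu : 0 ≤ u) :
    ∫ z in (0 : ℝ)..u, (Real.log (rectT l κ) - Real.log (rectT l' z)) ≤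
      rectEntropy l κ + |l' - l| * rectT l κ ^ 2 := by
  have hR : 0 ≤ rectT l κ := zero_le_one.trans (one_le_rectT hl hκ)
  have key : ∀ v : ℝ, 0 ≤ v → v ≤ rectT l κ →
      ∫ z in (0 : ℝ)..v, (Real.log (rectT l κ) - Real.log (rectT l' z)) ≤
      rectEntropy l κ + |l' - l| * rectT l κ ^ 2 := by
    intro v hv hvR
    have h1 : ∫ z in (0 : ℝ)..v, (Real.log (rectT l κ) - Real.log (rectT l' z)) ≤
        ∫ z in (0 : ℝ)..v, ((Real.log (rectT l κ) - Real.log (rectT l z)) +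
          |l' - l| * rectT l κ) := by
      refine intervalIntegral.integral_mono_on hv (intervalIntegrable_sub_log_rectT hl' _ le_rfl hv)
        ((intervalIntegrable_sub_log_rectT hl _ le_rfl hv).add intervalIntegrable_const)
        fun z hz => ?_
      have h2 := (abs_le.1 (abs_log_rectT_sub_le hl' hl hz.1)).1
      have h3 := mul_le_mul_of_nonneg_left (hz.2.trans hvR) (abs_nonneg (l' - l))
      linarith
    rw [intervalIntegral.integral_add (intervalIntegrable_sub_log_rectT hl _ le_rfl hv)
      intervalIntegrable_const, intervalIntegral.integral_const, smul_eq_mul, sub_zero] at h1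
    have h4 := integral_sub_log_rectT_le hl hκ hv
    have h5 : v * (|l' - l| * rectT l κ) ≤ |l' - l| * rectT l κ ^ 2 := by
      rw [sq, mul_comm v, mul_assoc]
      gcongr
    linarith
  rcases le_total u (rectT l κ) with h | h
  · exact key u hu h
  · rw [← intervalIntegral.integral_add_adjacent_intervals
      (intervalIntegrable_sub_log_rectT hl' _ le_rfl hR)
      (intervalIntegrable_sub_log_rectT hl' _ hR hu)]
    have : ∫ z in (rectT l κ)..u, (Real.log (rectT l κ) - Real.log (rectT l' z)) ≤
        ∫ z in (rectT l κ)..u, (0 : ℝ) := by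
      refine intervalIntegral.integral_mono_on h
        (intervalIntegrable_sub_log_rectT hl' _ hR hu) intervalIntegrable_const fun z hz => ?_
      have h1 := one_add_le_rectT hl' (hR.trans hz.1)
      have h2 := Real.log_le_log (zero_lt_one.trans_le (one_le_rectT hl hκ))
        ((by linarith [hz.1] : rectT l κ ≤ rectT l' z))
      linarith
    simp only [intervalIntegral.integral_zero] at this
    linarith [key _ hR le_rfl]

theorem le_integral_sub_log_rectT_perturb {l l' κ u : ℝ} (hl : 0 ≤ l) (hl' : 0 ≤ l')
    (hκ : 0 ≤ κ) (hu : 0 ≤ u) (huκ : u ≤ κ + 1) :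
    rectEntropy l κ - Real.log (rectT l (κ + 1)) * |u - κ| - |l' - l| * (κ + 1) ^ 2 ≤
      ∫ z in (0 : ℝ)..u, (Real.log (rectT l κ) - Real.log (rectT l' z)) := by
  have h1 : ∫ z in (0 : ℝ)..u, ((Real.log (rectT l κ) - Real.log (rectT l z)) -
      |l' - l| * (κ + 1)) ≤
      ∫ z in (0 : ℝ)..u, (Real.log (rectT l κ) - Real.log (rectT l' z)) := by
    refine intervalIntegral.integral_mono_on hu
      ((intervalIntegrable_sub_log_rectT hl _ le_rfl hu).sub intervalIntegrable_const)
      (intervalIntegrable_sub_log_rectT hl' _ le_rfl hu) fun z hz => ?_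
    have h2 := (abs_le.1 (abs_log_rectT_sub_le hl' hl hz.1)).2
    have h3 := mul_le_mul_of_nonneg_left (hz.2.trans huκ) (abs_nonneg (l' - l))
    linarith
  rw [intervalIntegral.integral_sub (intervalIntegrable_sub_log_rectT hl _ le_rfl hu)
    intervalIntegrable_const, intervalIntegral.integral_const, smul_eq_mul, sub_zero] at h1
  have h5 : u * (|l' - l| * (κ + 1)) ≤ |l' - l| * (κ + 1) ^ 2 := by
    rw [sq, mul_comm u, mul_assoc]
    gcongr
  linarith [rectEntropy_sub_le_integral hl hκ hu huκ]

/-- The summands decrease in i, so the sum is compared with an integral; the extra log T(κ) is the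
term i = 0, as T(0) = 1. -/
theorem sum_sub_log_rectT_le {l l' κ N : ℝ} (hl : 0 ≤ l) (hl' : 0 ≤ l') (hκ : 0 ≤ κ)
    (hN : 0 < N) (k : ℕ) :
    ∑ i ∈ Finset.range k, (Real.log (rectT l κ) - Real.log (rectT l' (i / N))) ≤
      N * (rectEntropy l κ + |l' - l| * rectT l κ ^ 2) + Real.log (rectT l κ) := by
  have hc := Real.log_nonneg (one_le_rectT hl hκ)
  have hanti := antitoneOn_sub_log_rectT hl' (Real.log (rectT l κ))
  cases k with
  | zero =>
    have h := integral_sub_log_rectT_perturb_le hl hl' hκ (le_refl (0 : ℝ))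
    rw [intervalIntegral.integral_same] at h
    simp only [Finset.range_zero, Finset.sum_empty]
    positivity
  | succ k =>
    have h1 := sum_div_le_integral hanti hN k
    have h2 := integral_sub_log_rectT_perturb_le hl hl' hκ (u := k / N) (by positivity)
    have h3 := mul_le_mul_of_nonneg_left h2 hN.le
    have h4 : rectT l' 0 = 1 := by simp [rectT]
    simp only [h4, Real.log_one, sub_zero] at h1
    linarith

theorem le_sum_sub_log_rectT {l l' κ N : ℝ} (hl : 0 ≤ l) (hl' : 0 ≤ l') (hκ : 0 ≤ κ)
    (hN : 0 < N) (k : ℕ) (hk : (k : ℝ) / N ≤ κ + 1) :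
    N * (rectEntropy l κ - Real.log (rectT l (κ + 1)) * |k / N - κ| - |l' - l| * (κ + 1) ^ 2) ≤
      ∑ i ∈ Finset.range k, (Real.log (rectT l κ) - Real.log (rectT l' (i / N))) := by
  refine le_trans ?_ (integral_le_sum_div (antitoneOn_sub_log_rectT hl' _) hN k)
  gcongr
  exact le_integral_sub_log_rectT_perturb hl hl' hκ (by positivity) hk

/-- A Chernoff bound: the tilted sum equals exp(N(φₙ(x eˢ) - s d)), exponentially smaller than exp(N
φₙ(x)) by `hd`. The constant 1/4 lets two tails together remove at most half of the mass. -/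
theorem eventually_tilted_sum_le {N : ℕ → ℝ} (hN : Tendsto N atTop atTop) {p : ℕ → ℕ → ℝ}
    {φn : ℕ → ℝ → ℝ} {φ : ℝ → ℝ} {x s d : ℝ}
    (hsum : ∀ᶠ n in atTop, HasSum (fun k => p n k * (x * Real.exp s) ^ k)
      (Real.exp (N n * φn n (x * Real.exp s))))
    (hφx : Tendsto (fun n => φn n x) atTop (𝓝 (φ x)))
    (hφs : Tendsto (fun n => φn n (x * Real.exp s)) atTop (𝓝 (φ (x * Real.exp s))))
    (hd : φ (x * Real.exp s) - φ x < s * d) :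
    ∀ᶠ n in atTop, Summable (fun k => p n k * x ^ k * Real.exp (s * (k - d * N n))) ∧
      ∑' k, p n k * x ^ k * Real.exp (s * (k - d * N n)) ≤
        1 / 4 * Real.exp (N n * φn n x) := by
  obtain ⟨η, hη0, hη⟩ : ∃ η > 0, φ (x * Real.exp s) - φ x < s * d - η :=
    ⟨(s * d - (φ (x * Real.exp s) - φ x)) / 2, by linarith, by linarith⟩
  have h1 : ∀ᶠ n in atTop, φn n (x * Real.exp s) - φn n x < s * d - η :=
    (hφs.sub hφx).eventually_lt_const hη
  -- Makes exp(-ηN) at most 1/4.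
  have h2 : ∀ᶠ n in atTop, Real.log 4 / η ≤ N n := hN.eventually_ge_atTop _
  filter_upwards [hsum, h1, h2, hN.eventually_gt_atTop 0] with n hs h1 h2 hN0
  have e1 : ∀ k : ℕ, p n k * (x * Real.exp s) ^ k * Real.exp (-(s * d * N n)) =
      p n k * x ^ k * Real.exp (s * (k - d * N n)) := by
    intro k
    rw [mul_pow, ← Real.exp_nat_mul, ← mul_assoc, mul_assoc (p n k * x ^ k), ← Real.exp_add]
    congr 2
    ring
  have h3 := hs.mul_right (Real.exp (-(s * d * N n)))
  simp_rw [e1] at h3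
  refine ⟨h3.summable, ?_⟩
  rw [h3.tsum_eq, ← Real.exp_add]
  have h4 : (1 / 4 : ℝ) = Real.exp (-Real.log 4) := by
    rw [Real.exp_neg, Real.exp_log (by norm_num)]
    norm_num
  rw [h4, ← Real.exp_add]
  refine Real.exp_le_exp.2 ?_
  rw [div_le_iff₀ hη0] at h2
  nlinarith [mul_lt_mul_of_pos_left h1 hN0]

/-- The map s ↦ φ(x eˢ) has derivative κ at 0, so small tilts of either sign satisfy the Chernoff
condition at κ ± δ. -/
theorem exists_tilt {φ : ℝ → ℝ} {x κ R δ : ℝ} (hx : 0 < x) (hxR : x < R) (hδ : 0 < δ)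
    (hφ : HasDerivAt φ (κ / x) x) :
    (∃ s > 0, x * Real.exp s < R ∧ φ (x * Real.exp s) - φ x < s * (κ + δ)) ∧
    (∃ s < 0, x * Real.exp s < R ∧ φ (x * Real.exp s) - φ x < s * (κ - δ)) := by
  have h1 : HasDerivAt (fun s => φ (x * Real.exp s)) κ 0 := by
    have h2 : HasDerivAt (fun s => x * Real.exp s) (x * Real.exp 0) 0 :=
      (Real.hasDerivAt_exp 0).const_mul x
    have hφ' : HasDerivAt φ (κ / x) (x * Real.exp 0) := by simpa using hφ
    have := hφ'.comp 0 h2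
    simpa [div_mul_cancel₀ _ hx.ne', Function.comp_def] using this
  have hc : ∀ᶠ s in 𝓝 (0 : ℝ), x * Real.exp s < R := by
    have : Tendsto (fun s => x * Real.exp s) (𝓝 0) (𝓝 (x * Real.exp 0)) :=
      (continuous_const.mul Real.continuous_exp).tendsto 0
    refine this.eventually_lt_const ?_
    simpa using hxR
  have hslope := hasDerivAt_iff_tendsto_slope.1 h1
  constructor
  · have h2 := (hslope.mono_left (nhdsGT_le_nhdsNE 0)).eventually_lt_const
      (by linarith : κ < κ + δ)
    obtain ⟨s, ⟨hs1, hs2⟩, hs0⟩ := ((h2.and (hc.filter_mono nhdsWithin_le_nhds)).and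
      self_mem_nhdsWithin).exists
    refine ⟨s, hs0, hs2, ?_⟩
    simp only [slope_def_field, Real.exp_zero, mul_one, sub_zero] at hs1
    rw [div_lt_iff₀ hs0] at hs1
    linarith
  · have h2 := (hslope.mono_left (nhdsLT_le_nhdsNE 0)).eventually_const_lt
      (by linarith : κ - δ < κ)
    obtain ⟨s, ⟨hs1, hs2⟩, hs0⟩ := ((h2.and (hc.filter_mono nhdsWithin_le_nhds)).and
      self_mem_nhdsWithin).exists
    refine ⟨s, hs0, hs2, ?_⟩
    simp only [slope_def_field, Real.exp_zero, mul_one, sub_zero] at hs1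
    rw [lt_div_iff_of_neg hs0] at hs1
    linarith

theorem tilted_term_eq {p x l l' κ N : ℝ} (hl : 0 ≤ l) (hl' : 0 ≤ l') (hκ : 0 ≤ κ) (hN : 0 < N)
    (k : ℕ) :
    p * (x * rectT l κ) ^ k / ∏ i ∈ Finset.range k, rectT l' (i / N) =
      p * x ^ k * Real.exp
        (∑ i ∈ Finset.range k, (Real.log (rectT l κ) - Real.log (rectT l' (i / N)))) := by
  have hT : 0 < rectT l κ := zero_lt_one.trans_le (one_le_rectT hl hκ)
  have hT' : ∀ i : ℕ, 0 < rectT l' (i / N) := fun i =>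
    zero_lt_one.trans_le (one_le_rectT hl' (by positivity))
  rw [Real.exp_sum]
  simp_rw [Real.exp_sub, Real.exp_log hT, Real.exp_log (hT' _)]
  rw [Finset.prod_div_distrib, Finset.prod_const, Finset.card_range, mul_pow]
  ring

/-- Upper bound: the exponent is at most N(A + ε/2) for every k. Lower bound: within |k/N - κ| ≤ δ
it is at least N(A - ε/2), and the Chernoff bounds on the two tails leave at least half of the mass
Σ p_k x^k there. -/
theorem tendsto_log_weighted_series {N l : ℕ → ℝ} {lam : ℝ} (hN : Tendsto N atTop atTop)
    (hl : ∀ n, 0 ≤ l n) (hlam : Tendsto l atTop (𝓝 lam)) {p : ℕ → ℕ → ℝ}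
    (hp : ∀ n k, 0 ≤ p n k) {φn : ℕ → ℝ → ℝ} {φ : ℝ → ℝ} {R : ℝ}
    (hsum : ∀ x, 0 < x → x < R → ∀ᶠ n in atTop,
      HasSum (fun k => p n k * x ^ k) (Real.exp (N n * φn n x)))
    (hφ : ∀ x, 0 < x → x < R → Tendsto (fun n => φn n x) atTop (𝓝 (φ x)))
    {x κ : ℝ} (hx : 0 < x) (hxR : x < R) (hκ : 0 ≤ κ) (hderiv : HasDerivAt φ (κ / x) x) :
    Tendsto (fun n => 1 / N n * Real.log (∑' k, p n k * (x * rectT lam κ) ^ k /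
      ∏ i ∈ Finset.range k, rectT (l n) (i / N n))) atTop (𝓝 (φ x + rectEntropy lam κ)) := by
  have hlam0 : 0 ≤ lam := ge_of_tendsto' hlam hl
  have hT : 0 < rectT lam κ := zero_lt_one.trans_le (one_le_rectT hlam0 hκ)
  set A := rectEntropy lam κ with hA
  have habs : Tendsto (fun n => |l n - lam|) atTop (𝓝 0) := by
    have := (hlam.sub_const lam).abs
    simpa using this
  have hNinv : Tendsto (fun n => 1 / N n) atTop (𝓝 0) := by
    simp_rw [one_div]
    exact hN.inv_tendsto_atTop
  set L := Real.log (rectT lam (κ + 1)) with hL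
  have hL0 : 0 ≤ L := Real.log_nonneg (one_le_rectT hlam0 (by linarith))
  rw [Metric.tendsto_atTop']
  intro ε hε
  -- L is the Lipschitz-type constant of `le_sum_sub_log_rectT`, which also needs k/N ≤ κ + 1; hence
  -- δ ≤ 1.
  obtain ⟨δ, hδ0, hδ1, hδ⟩ : ∃ δ > 0, δ ≤ 1 ∧ L * δ ≤ ε / 4 := by
    refine ⟨min 1 (ε / (4 * (L + 1))), by positivity, min_le_left _ _, ?_⟩
    calc L * min 1 (ε / (4 * (L + 1))) ≤ (L + 1) * (ε / (4 * (L + 1))) := by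
          gcongr
          · linarith
          · exact min_le_right _ _
      _ = ε / 4 := by field_simp
  obtain ⟨⟨s₁, hs₁, hs₁R, hs₁d⟩, ⟨s₂, hs₂, hs₂R, hs₂d⟩⟩ := exists_tilt hx hxR hδ0 hderiv
  have hx₁ : 0 < x * Real.exp s₁ := by positivity
  have hx₂ : 0 < x * Real.exp s₂ := by positivity
  have ev1 := eventually_tilted_sum_le hN (hsum _ hx₁ hs₁R) (hφ x hx hxR) (hφ _ hx₁ hs₁R) hs₁d
  have ev2 := eventually_tilted_sum_le hN (hsum _ hx₂ hs₂R) (hφ x hx hxR) (hφ _ hx₂ hs₂R) hs₂d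
  have ev3 : ∀ᶠ n in atTop, |l n - lam| * rectT lam κ ^ 2 < ε / 4 :=
    (habs.mul_const (rectT lam κ ^ 2)).eventually_lt_const (by simpa using by positivity)
  have ev4 : ∀ᶠ n in atTop, |l n - lam| * (κ + 1) ^ 2 < ε / 4 :=
    (habs.mul_const ((κ + 1) ^ 2)).eventually_lt_const (by simpa using by positivity)
  have ev5 : ∀ᶠ n in atTop, 1 / N n * Real.log (rectT lam κ) < ε / 4 :=
    (hNinv.mul_const _).eventually_lt_const (by simpa using by positivity)
  have ev6 : ∀ᶠ n in atTop, 1 / N n * Real.log 2 < ε / 4 :=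
    (hNinv.mul_const _).eventually_lt_const (by simpa using by positivity)
  have ev7 : ∀ᶠ n in atTop, |φn n x - φ x| < ε / 4 := by
    have := Metric.tendsto_nhds.1 (hφ x hx hxR) (ε / 4) (by positivity)
    simpa [Real.dist_eq] using this
  have ev8 := hN.eventually_gt_atTop 0
  have main : ∀ᶠ n in atTop, dist (1 / N n * Real.log (∑' k, p n k * (x * rectT lam κ) ^ k /
      ∏ i ∈ Finset.range k, rectT (l n) (i / N n))) (φ x + A) < ε := by
    filter_upwards [ev1, ev2, ev3, ev4, ev5, ev6, ev7, ev8, hsum x hx hxR] with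
      n ⟨sm1, le1⟩ ⟨sm2, le2⟩ h3 h4 h5 h6 h7 hN0 hs
    simp_rw [tilted_term_eq hlam0 (hl n) hκ hN0]
    set a : ℕ → ℝ := fun k =>
      ∑ i ∈ Finset.range k, (Real.log (rectT lam κ) - Real.log (rectT (l n) (i / N n))) with ha
    have hp' : ∀ k, 0 ≤ p n k * x ^ k := fun k => mul_nonneg (hp n k) (by positivity)
    have hup : ∀ k, a k ≤ N n * (A + ε / 2) := by
      intro k
      refine (sum_sub_log_rectT_le hlam0 (hl n) hκ hN0 k).trans ?_
      have : Real.log (rectT lam κ) ≤ N n * (ε / 4) := by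
        have := mul_lt_mul_of_pos_left h5 hN0
        rw [← mul_assoc, mul_one_div_cancel hN0.ne', one_mul] at this
        exact this.le
      have := mul_lt_mul_of_pos_left h3 hN0
      linarith
    have hterm_le : ∀ k, p n k * x ^ k * Real.exp (a k) ≤
        p n k * x ^ k * Real.exp (N n * (A + ε / 2)) := fun k =>
      mul_le_mul_of_nonneg_left (Real.exp_le_exp.2 (hup k)) (hp' k)
    have hsm : Summable fun k => p n k * x ^ k * Real.exp (a k) :=
      Summable.of_nonneg_of_le (fun k => mul_nonneg (hp' k) (Real.exp_pos _).le) hterm_le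
        (hs.mul_right _).summable
    have hF_le : ∑' k, p n k * x ^ k * Real.exp (a k) ≤
        Real.exp (N n * (φn n x + A + ε / 2)) := by
      refine (hsm.tsum_le_tsum hterm_le (hs.mul_right _).summable).trans_eq ?_
      rw [(hs.mul_right _).tsum_eq, ← Real.exp_add]
      congr 1
      ring
    have hlow : ∀ k : ℕ, |(k : ℝ) / N n - κ| ≤ δ → N n * (A - ε / 2) ≤ a k := by
      intro k hk
      refine le_trans ?_ (le_sum_sub_log_rectT hlam0 (hl n) hκ hN0 k
        (by linarith [(abs_le.1 hk).2]))
      have := mul_le_mul_of_nonneg_left hk hL0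
      have : A - ε / 2 ≤ A - L * |(k : ℝ) / N n - κ| - |l n - lam| * (κ + 1) ^ 2 := by linarith
      exact mul_le_mul_of_nonneg_left this hN0.le
    -- The two exponentials replace indicators of the tails: outside the window one of them is at
    -- least 1, so the bracket is nonpositive and the bound is trivial.
    have hterm_ge : ∀ k : ℕ, Real.exp (N n * (A - ε / 2)) * (p n k * x ^ k -
        p n k * x ^ k * Real.exp (s₁ * (k - (κ + δ) * N n)) -
        p n k * x ^ k * Real.exp (s₂ * (k - (κ - δ) * N n))) ≤
        p n k * x ^ k * Real.exp (a k) := by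
      intro k
      have hfac : p n k * x ^ k -
          p n k * x ^ k * Real.exp (s₁ * (k - (κ + δ) * N n)) -
          p n k * x ^ k * Real.exp (s₂ * (k - (κ - δ) * N n)) =
          p n k * x ^ k * (1 - Real.exp (s₁ * (k - (κ + δ) * N n)) -
            Real.exp (s₂ * (k - (κ - δ) * N n))) := by ring
      rw [hfac, mul_left_comm]
      refine mul_le_mul_of_nonneg_left ?_ (hp' k)
      have hE1 := Real.exp_pos (s₁ * (k - (κ + δ) * N n))
      have hE2 := Real.exp_pos (s₂ * (k - (κ - δ) * N n))
      by_cases hk : |(k : ℝ) / N n - κ| ≤ δ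
      · have := Real.exp_le_exp.2 (hlow k hk)
        refine le_trans ?_ this
        have h0 := Real.exp_pos (N n * (A - ε / 2))
        nlinarith
      · have hneg : 1 - Real.exp (s₁ * (k - (κ + δ) * N n)) -
            Real.exp (s₂ * (k - (κ - δ) * N n)) ≤ 0 := by
          rw [not_le, lt_abs] at hk
          rcases hk with hk | hk
          · have : κ + δ < (k : ℝ) / N n := by linarith
            rw [lt_div_iff₀ hN0] at this
            have := Real.one_le_exp (mul_nonneg hs₁.le (sub_nonneg.2 this.le))
            linarith
          · have : (k : ℝ) / N n < κ - δ := by linarith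
            rw [div_lt_iff₀ hN0] at this
            have := Real.one_le_exp (mul_nonneg_of_nonpos_of_nonpos hs₂.le (sub_nonpos.2 this.le))
            linarith
        have h0 := Real.exp_pos (N n * (A - ε / 2))
        have h1 := Real.exp_pos (a k)
        nlinarith
    -- The log 2 records the mass 1 - 1/4 - 1/4 left after removing the tails.
    have hF_ge : Real.exp (N n * (φn n x + A - ε / 2) - Real.log 2) ≤
        ∑' k, p n k * x ^ k * Real.exp (a k) := by
      have hsub := (hs.summable.sub sm1).sub sm2
      have := (hsub.mul_left (Real.exp (N n * (A - ε / 2)))).tsum_le_tsum hterm_ge hsm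
      refine le_trans ?_ this
      rw [tsum_mul_left, (hs.summable.sub sm1).tsum_sub sm2, hs.summable.tsum_sub sm1, hs.tsum_eq]
      have h8 : N n * (φn n x + A - ε / 2) - Real.log 2 =
          N n * (A - ε / 2) + (N n * φn n x - Real.log 2) := by ring
      rw [h8, Real.exp_add]
      refine mul_le_mul_of_nonneg_left ?_ (Real.exp_pos _).le
      rw [Real.exp_sub, Real.exp_log (by norm_num)]
      linarith
    set F := ∑' k, p n k * x ^ k * Real.exp (a k)
    have hF0 : 0 < F := (Real.exp_pos _).trans_le hF_ge
    have hlog1 := Real.log_le_log hF0 hF_le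
    have hlog2 := Real.log_le_log (Real.exp_pos _) hF_ge
    rw [Real.log_exp] at hlog1 hlog2
    have hinv : 0 < 1 / N n := by positivity
    have g1 := mul_le_mul_of_nonneg_left hlog1 hinv.le
    have g2 := mul_le_mul_of_nonneg_left hlog2 hinv.le
    rw [← mul_assoc, one_div_mul_cancel hN0.ne', one_mul] at g1
    rw [mul_sub, ← mul_assoc, one_div_mul_cancel hN0.ne', one_mul] at g2
    rw [abs_lt] at h7
    rw [Real.dist_eq, abs_lt]
    constructor <;> linarith
  obtain ⟨n₀, hn₀⟩ := eventually_atTop.1 main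
  exact ⟨n₀, fun n hn => hn₀ n hn.le⟩

end Asymptotics

/-! ### The rectangular `R`-transform of a compactly supported measure -/

section Transform

variable {μ : Measure ℝ} {K lam : ℝ}

/-- The function `x ↦ -∫ log (1 - t² x) dμ(t)`. -/
noncomputable def logPotentialSq (μ : Measure ℝ) (x : ℝ) : ℝ :=
  ∫ t, -Real.log (1 - t ^ 2 * x) ∂μ

theorem sq_mul_lt_one (hK : 0 < K) {t x : ℝ} (ht : t ^ 2 ≤ K ^ 2) (hx0 : 0 ≤ x)
    (hx : x < (K ^ 2)⁻¹) : t ^ 2 * x < 1 := by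
  have h1 : t ^ 2 * x ≤ K ^ 2 * x := by gcongr
  have h2 : K ^ 2 * x < K ^ 2 * (K ^ 2)⁻¹ := by gcongr
  rw [mul_inv_cancel₀ (by positivity)] at h2
  linarith

/-- The bound holds on a whole half-line x < x₁, a neighbourhood of x₀ even when x₀ = 0, so
differentiation under the integral is two-sided there. -/
theorem exists_between_pos_lower_bound (hK : 0 < K) {x₀ : ℝ} (hx0 : 0 ≤ x₀)
    (hx : x₀ < (K ^ 2)⁻¹) :
    ∃ x₁ > x₀, ∃ c > 0, c ≤ 1 ∧ ∀ t : ℝ, t ^ 2 ≤ K ^ 2 → ∀ x < x₁, c ≤ 1 - t ^ 2 * x := by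
  obtain ⟨x₁, h01, h1R⟩ := exists_between hx
  have h1 := sq_mul_lt_one hK (le_refl (K ^ 2)) (hx0.trans h01.le) h1R
  have hx1 : 0 ≤ x₁ := hx0.trans h01.le
  refine ⟨x₁, h01, 1 - K ^ 2 * x₁, by linarith, by linarith [mul_nonneg (sq_nonneg K) hx1],
    fun t ht x hx => ?_⟩
  have h2 : t ^ 2 * x ≤ t ^ 2 * x₁ := by gcongr
  have h3 : t ^ 2 * x₁ ≤ K ^ 2 * x₁ := by gcongr
  linarith

theorem hasDerivAt_integral_of_bounded [IsProbabilityMeasure μ]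
    (hμ : ∀ᵐ t ∂μ, t ^ 2 ≤ K ^ 2) {F F' : ℝ → ℝ → ℝ} {x₀ x₁ B₀ B : ℝ} (hx : x₀ < x₁)
    (hF : ∀ x, Measurable (F x)) (hF' : Measurable (F' x₀))
    (hB₀ : ∀ t, t ^ 2 ≤ K ^ 2 → |F x₀ t| ≤ B₀)
    (hB : ∀ t, t ^ 2 ≤ K ^ 2 → ∀ x < x₁, |F' x t| ≤ B)
    (hd : ∀ t, t ^ 2 ≤ K ^ 2 → ∀ x < x₁, HasDerivAt (fun x => F x t) (F' x t) x) :
    HasDerivAt (fun x => ∫ t, F x t ∂μ) (∫ t, F' x₀ t ∂μ) x₀ := by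
  refine (hasDerivAt_integral_of_dominated_loc_of_deriv_le (bound := fun _ => B)
    (Iio_mem_nhds hx) (Eventually.of_forall fun x => (hF x).aestronglyMeasurable) ?_
    hF'.aestronglyMeasurable ?_ (integrable_const _) ?_).2
  · refine (integrable_const B₀).mono' (hF x₀).aestronglyMeasurable ?_
    filter_upwards [hμ] with t ht using hB₀ t ht
  · filter_upwards [hμ] with t ht x hx using hB t ht x hx
  · filter_upwards [hμ] with t ht x hx using hd t ht x hx

theorem hasDerivAt_logPotentialSq [IsProbabilityMeasure μ] (hK : 0 < K)
    (hμ : ∀ᵐ t ∂μ, t ^ 2 ≤ K ^ 2) {x : ℝ} (hx0 : 0 ≤ x) (hx : x < (K ^ 2)⁻¹) :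
    HasDerivAt (logPotentialSq μ) (∫ t, t ^ 2 / (1 - t ^ 2 * x) ∂μ) x := by
  obtain ⟨x₁, hx₁, c, hc, hc1, hb⟩ := exists_between_pos_lower_bound hK hx0 hx
  refine hasDerivAt_integral_of_bounded (B₀ := -Real.log c) (B := K ^ 2 / c)
    (F := fun x t => -Real.log (1 - t ^ 2 * x)) (F' := fun x t => t ^ 2 / (1 - t ^ 2 * x))
    hμ hx₁ (fun x => by fun_prop) (by fun_prop) (fun t ht => ?_) (fun t ht x hx => ?_)
    (fun t ht x hx => ?_)
  · have h1 := hb t ht x hx₁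
    have h2 : 1 - t ^ 2 * x ≤ 1 := by linarith [mul_nonneg (sq_nonneg t) hx0]
    have h3 := Real.log_le_log hc h1
    have h4 := Real.log_nonpos (hc.le.trans h1) h2
    rw [abs_neg, abs_of_nonpos h4]
    linarith
  · have h1 := hb t ht x hx
    have h2 : 0 < 1 - t ^ 2 * x := hc.trans_le h1
    rw [abs_of_nonneg (by positivity)]
    gcongr
  · have h1 := hb t ht x hx
    have h2 : 0 < 1 - t ^ 2 * x := hc.trans_le h1
    have h3 : HasDerivAt (fun x => 1 - t ^ 2 * x) (-(t ^ 2)) x := by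
      simpa using ((hasDerivAt_id x).const_mul (t ^ 2)).const_sub 1
    have := (h3.log h2.ne').neg
    exact this.congr_deriv (by ring)

theorem hasDerivAt_momentGenSq [IsProbabilityMeasure μ] (hK : 0 < K)
    (hμ : ∀ᵐ t ∂μ, t ^ 2 ≤ K ^ 2) {x : ℝ} (hx0 : 0 ≤ x) (hx : x < (K ^ 2)⁻¹) :
    HasDerivAt (momentGenSq μ) (∫ t, t ^ 2 / (1 - t ^ 2 * x) ^ 2 ∂μ) x := by
  obtain ⟨x₁, hx₁, c, hc, hc1, hb⟩ := exists_between_pos_lower_bound hK hx0 hx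
  refine hasDerivAt_integral_of_bounded (B₀ := K ^ 2 * x / c) (B := K ^ 2 / c ^ 2)
    (F := fun x t => t ^ 2 * x / (1 - t ^ 2 * x)) (F' := fun x t => t ^ 2 / (1 - t ^ 2 * x) ^ 2)
    hμ hx₁ (fun x => by fun_prop) (by fun_prop) (fun t ht => ?_) (fun t ht x hx => ?_)
    (fun t ht x hx => ?_)
  · have h1 := hb t ht x hx₁
    have h2 : 0 < 1 - t ^ 2 * x := hc.trans_le h1
    rw [abs_of_nonneg (by positivity)]
    gcongr
  · have h1 := hb t ht x hx
    have h2 : 0 < 1 - t ^ 2 * x := hc.trans_le h1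
    rw [abs_of_nonneg (by positivity)]
    gcongr
  · have h1 := hb t ht x hx
    have h2 : 0 < 1 - t ^ 2 * x := hc.trans_le h1
    have h4 : HasDerivAt (fun x => t ^ 2 * x) (t ^ 2) x := by
      simpa using (hasDerivAt_id x).const_mul (t ^ 2)
    have := h4.div (h4.const_sub 1) h2.ne'
    exact this.congr_deriv (by ring)

/-- This is M(x) = x φ'(x), the saddle point relation linking the moment function to the logarithmic
potential. -/
theorem momentGenSq_eq_mul (x : ℝ) :
    momentGenSq μ x = x * ∫ t, t ^ 2 / (1 - t ^ 2 * x) ∂μ := by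
  rw [momentGenSq, ← integral_const_mul]
  congr 1
  ext t
  ring

theorem momentGenSq_zero : momentGenSq μ 0 = 0 := by simp [momentGenSq]

theorem momentGenSq_nonneg (hK : 0 < K)
    (hμ : ∀ᵐ t ∂μ, t ^ 2 ≤ K ^ 2) {x : ℝ} (hx0 : 0 ≤ x) (hx : x < (K ^ 2)⁻¹) :
    0 ≤ momentGenSq μ x := by
  refine integral_nonneg_of_ae ?_
  filter_upwards [hμ] with t ht
  have h1 := sq_mul_lt_one hK ht hx0 hx
  exact div_nonneg (by positivity) (by linarith)

theorem momentGenSq_le [IsProbabilityMeasure μ] (hK : 0 < K)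
    (hμ : ∀ᵐ t ∂μ, t ^ 2 ≤ K ^ 2) {x : ℝ} (hx0 : 0 ≤ x) (hx : x < (K ^ 2)⁻¹) :
    momentGenSq μ x ≤ K ^ 2 * x / (1 - K ^ 2 * x) := by
  have hKx := sq_mul_lt_one hK (le_refl (K ^ 2)) hx0 hx
  have h : momentGenSq μ x ≤ ∫ _, K ^ 2 * x / (1 - K ^ 2 * x) ∂μ := by
    refine integral_mono_of_nonneg ?_ (integrable_const _) ?_
    · filter_upwards [hμ] with t ht
      have h1 := sq_mul_lt_one hK ht hx0 hx
      exact div_nonneg (by positivity) (by linarith)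
    · filter_upwards [hμ] with t ht
      have h2 : 0 < 1 - K ^ 2 * x := by linarith
      gcongr
  simpa using h

theorem momentGenSq_monotoneOn [IsProbabilityMeasure μ] (hK : 0 < K)
    (hμ : ∀ᵐ t ∂μ, t ^ 2 ≤ K ^ 2) : MonotoneOn (momentGenSq μ) (Ico 0 (K ^ 2)⁻¹) := by
  refine monotoneOn_of_deriv_nonneg (convex_Ico _ _)
    (fun x hx => (hasDerivAt_momentGenSq hK hμ hx.1 hx.2).continuousAt.continuousWithinAt) ?_ ?_
  · rw [interior_Ico]
    exact fun x hx =>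
      (hasDerivAt_momentGenSq hK hμ hx.1.le hx.2).differentiableAt.differentiableWithinAt
  · rw [interior_Ico]
    intro x hx
    rw [(hasDerivAt_momentGenSq hK hμ hx.1.le hx.2).deriv]
    exact integral_nonneg fun t => by positivity

theorem rectH_zero : rectH lam μ 0 = 0 := by simp [rectH]

/-- T(M(x)) is at least 1 and nondecreasing. This single estimate yields that H is injective, that
its range contains [0, K⁻²), and that its inverse is 1-Lipschitz there. -/
theorem sub_le_rectH_sub [IsProbabilityMeasure μ] (hK : 0 < K) (hμ : ∀ᵐ t ∂μ, t ^ 2 ≤ K ^ 2)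
    (hlam : 0 ≤ lam) {x x' : ℝ} (hx : x ∈ Ico 0 (K ^ 2)⁻¹) (hx' : x' ∈ Ico 0 (K ^ 2)⁻¹)
    (h : x ≤ x') : x' - x ≤ rectH lam μ x' - rectH lam μ x := by
  have h0 := momentGenSq_nonneg hK hμ hx.1 hx.2
  have h1 := rectT_mono hlam h0 (momentGenSq_monotoneOn hK hμ hx hx' h)
  have h2 := one_le_rectT hlam (momentGenSq_nonneg hK hμ hx'.1 hx'.2)
  unfold rectH
  nlinarith [mul_le_mul_of_nonneg_left h1 hx.1,
    mul_le_mul_of_nonneg_left h2 (sub_nonneg.2 h)]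

theorem rectH_injOn [IsProbabilityMeasure μ] (hK : 0 < K) (hμ : ∀ᵐ t ∂μ, t ^ 2 ≤ K ^ 2)
    (hlam : 0 ≤ lam) : InjOn (rectH lam μ) (Ico 0 (K ^ 2)⁻¹) := by
  intro x hx x' hx' h
  rcases le_total x x' with hxx | hxx
  · linarith [sub_le_rectH_sub hK hμ hlam hx hx' hxx]
  · linarith [sub_le_rectH_sub hK hμ hlam hx' hx hxx]

theorem hasDerivAt_rectT (l z : ℝ) : HasDerivAt (rectT l) (2 * l * z + l + 1) z := by
  have h1 : HasDerivAt (fun z : ℝ => l * z + 1) l z := by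
    simpa using ((hasDerivAt_id z).const_mul l).add_const 1
  have := h1.mul ((hasDerivAt_id z).add_const 1)
  exact this.congr_deriv (by simp only [id_eq]; ring)

theorem hasDerivAt_rectH [IsProbabilityMeasure μ] (hK : 0 < K) (hμ : ∀ᵐ t ∂μ, t ^ 2 ≤ K ^ 2)
    {x : ℝ} (hx0 : 0 ≤ x) (hx : x < (K ^ 2)⁻¹) :
    HasDerivAt (rectH lam μ) (rectT lam (momentGenSq μ x) +
      x * ((2 * lam * momentGenSq μ x + lam + 1) * ∫ t, t ^ 2 / (1 - t ^ 2 * x) ^ 2 ∂μ)) x := by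
  have hM := hasDerivAt_momentGenSq hK hμ hx0 hx
  have hT := hasDerivAt_rectT lam (momentGenSq μ x)
  have := (hasDerivAt_id x).mul (hT.comp x hM)
  exact this.congr_deriv (by simp)

theorem exists_rectH_eq [IsProbabilityMeasure μ] (hK : 0 < K) (hμ : ∀ᵐ t ∂μ, t ^ 2 ≤ K ^ 2)
    (hlam : 0 ≤ lam) {y : ℝ} (hy : y ∈ Ico 0 (K ^ 2)⁻¹) :
    ∃ x ∈ Ico 0 (K ^ 2)⁻¹, rectH lam μ x = y := by
  have hc : ContinuousOn (rectH lam μ) (Icc 0 y) := fun x hx =>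
    (hasDerivAt_rectH hK hμ hx.1 (hx.2.trans_lt hy.2)).continuousAt.continuousWithinAt
  have h0 : (0 : ℝ) ∈ Ico 0 (K ^ 2)⁻¹ := ⟨le_rfl, by positivity⟩
  have h1 := sub_le_rectH_sub hK hμ hlam h0 hy hy.1
  rw [rectH_zero, sub_zero, sub_zero] at h1
  obtain ⟨x, hx, hxy⟩ := intermediate_value_Icc hy.1 hc
    (show y ∈ Icc (rectH lam μ 0) (rectH lam μ y) from ⟨by rw [rectH_zero]; exact hy.1, h1⟩)
  exact ⟨x, ⟨hx.1, hx.2.trans_lt hy.2⟩, hxy⟩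

theorem rectHInv_mem [IsProbabilityMeasure μ] (hK : 0 < K) (hμ : ∀ᵐ t ∂μ, t ^ 2 ≤ K ^ 2)
    (hlam : 0 ≤ lam) {y : ℝ} (hy : y ∈ Ico 0 (K ^ 2)⁻¹) :
    rectHInv K lam μ y ∈ Ico 0 (K ^ 2)⁻¹ :=
  Function.invFunOn_mem (exists_rectH_eq hK hμ hlam hy)

theorem rectH_rectHInv [IsProbabilityMeasure μ] (hK : 0 < K) (hμ : ∀ᵐ t ∂μ, t ^ 2 ≤ K ^ 2)
    (hlam : 0 ≤ lam) {y : ℝ} (hy : y ∈ Ico 0 (K ^ 2)⁻¹) :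
    rectH lam μ (rectHInv K lam μ y) = y :=
  Function.invFunOn_eq (exists_rectH_eq hK hμ hlam hy)

theorem rectHInv_zero [IsProbabilityMeasure μ] (hK : 0 < K) (hμ : ∀ᵐ t ∂μ, t ^ 2 ≤ K ^ 2)
    (hlam : 0 ≤ lam) : rectHInv K lam μ 0 = 0 := by
  have h0 : (0 : ℝ) ∈ Ico 0 (K ^ 2)⁻¹ := ⟨le_rfl, by positivity⟩
  exact rectH_injOn hK hμ hlam (rectHInv_mem hK hμ hlam h0) h0
    ((rectH_rectHInv hK hμ hlam h0).trans rectH_zero.symm)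

theorem rectHInv_le [IsProbabilityMeasure μ] (hK : 0 < K) (hμ : ∀ᵐ t ∂μ, t ^ 2 ≤ K ^ 2)
    (hlam : 0 ≤ lam) {y : ℝ} (hy : y ∈ Ico 0 (K ^ 2)⁻¹) : rectHInv K lam μ y ≤ y := by
  have h0 : (0 : ℝ) ∈ Ico 0 (K ^ 2)⁻¹ := ⟨le_rfl, by positivity⟩
  have hm := rectHInv_mem hK hμ hlam hy
  have h1 := sub_le_rectH_sub hK hμ hlam h0 hm hm.1
  rw [rectH_zero, rectH_rectHInv hK hμ hlam hy] at h1
  linarith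

theorem rectHInv_pos [IsProbabilityMeasure μ] (hK : 0 < K) (hμ : ∀ᵐ t ∂μ, t ^ 2 ≤ K ^ 2)
    (hlam : 0 ≤ lam) {y : ℝ} (hy : y ∈ Ioo 0 (K ^ 2)⁻¹) : 0 < rectHInv K lam μ y := by
  have hy' : y ∈ Ico 0 (K ^ 2)⁻¹ := ⟨hy.1.le, hy.2⟩
  refine (rectHInv_mem hK hμ hlam hy').1.lt_of_ne fun h => ?_
  have := rectH_rectHInv hK hμ hlam hy'
  rw [← h, rectH_zero] at this
  exact hy.1.ne this

theorem continuousOn_rectHInv [IsProbabilityMeasure μ] (hK : 0 < K)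
    (hμ : ∀ᵐ t ∂μ, t ^ 2 ≤ K ^ 2) (hlam : 0 ≤ lam) :
    ContinuousOn (rectHInv K lam μ) (Ico 0 (K ^ 2)⁻¹) := by
  refine LipschitzOnWith.continuousOn (K := 1) (LipschitzOnWith.of_dist_le_mul fun y hy y' hy' => ?_)
  have h1 := rectHInv_mem hK hμ hlam hy
  have h2 := rectHInv_mem hK hμ hlam hy'
  have e1 := rectH_rectHInv hK hμ hlam hy
  have e2 := rectH_rectHInv hK hμ hlam hy'
  rw [NNReal.coe_one, one_mul, Real.dist_eq, Real.dist_eq]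
  rcases le_total (rectHInv K lam μ y) (rectHInv K lam μ y') with h | h
  · have := sub_le_rectH_sub hK hμ hlam h1 h2 h
    rw [e1, e2] at this
    rw [abs_sub_comm, abs_of_nonneg (sub_nonneg.2 h), abs_sub_comm]
    exact this.trans (le_abs_self _)
  · have := sub_le_rectH_sub hK hμ hlam h2 h1 h
    rw [e1, e2] at this
    rw [abs_of_nonneg (sub_nonneg.2 h)]
    exact this.trans (le_abs_self _)

theorem rectT_injOn (hlam : lam ∈ Icc (0 : ℝ) 1) : InjOn (rectT lam) (Ici (-1)) := by
  have key : ∀ z z' : ℝ, -1 ≤ z → z < z' → rectT lam z < rectT lam z' := by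
    intro z z' hz h
    unfold rectT
    have h1 : 0 ≤ lam * (z + 1) := mul_nonneg hlam.1 (by linarith)
    have h2 : 0 ≤ lam * (z' - z) := mul_nonneg hlam.1 (by linarith)
    -- For λ < 1 the slope of T at -1 is 1 - λ > 0; for λ = 1 it vanishes, and T(z) = (z + 1)².
    rcases hlam.2.lt_or_eq with h3 | h3
    · nlinarith [mul_pos (sub_pos.2 h) (sub_pos.2 h3), mul_nonneg h2 (by linarith : 0 ≤ z' + 1),
        mul_nonneg h1 (sub_nonneg.2 h.le)]
    · subst h3
      nlinarith
  intro z hz z' hz' h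
  rcases lt_trichotomy z z' with hlt | heq | hgt
  · exact absurd h (key z z' hz hlt).ne
  · exact heq
  · exact absurd h (key z' z hz' hgt).ne'

/-- With x = H⁻¹(y), the quotient y/x is T(M(x)), and M(x) ≥ 0 lies in the domain where T is
inverted. -/
theorem rectRTransform_eq [IsProbabilityMeasure μ] (hK : 0 < K) (hμ : ∀ᵐ t ∂μ, t ^ 2 ≤ K ^ 2)
    (hlam : lam ∈ Icc (0 : ℝ) 1) {y : ℝ} (hy : y ∈ Ico 0 (K ^ 2)⁻¹) :
    rectRTransform K lam μ y = momentGenSq μ (rectHInv K lam μ y) := by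
  unfold rectRTransform
  split_ifs with h
  · rw [h, rectHInv_zero hK hμ hlam.1, momentGenSq_zero]
  · have hpos := rectHInv_pos hK hμ hlam.1 (y := y) ⟨hy.1.lt_of_ne (Ne.symm h), hy.2⟩
    have hm := rectHInv_mem hK hμ hlam.1 hy
    have h1 : y / rectHInv K lam μ y = rectT lam (momentGenSq μ (rectHInv K lam μ y)) := by
      rw [div_eq_iff hpos.ne', mul_comm]
      exact (rectH_rectHInv hK hμ hlam.1 hy).symm
    rw [h1]
    refine (rectT_injOn hlam).leftInvOn_invFunOn ?_
    have := momentGenSq_nonneg hK hμ hm.1 hm.2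
    exact mem_Ici.2 (by linarith)

/-- The primitive `y ↦ ∫₀^y C(u)/u du` of the rectangular `R`-transform, expressed
as a function of `x` with `y = H(x)`. -/
noncomputable def rectPrimitive (lam : ℝ) (μ : Measure ℝ) (x : ℝ) : ℝ :=
  logPotentialSq μ x + rectEntropy lam (momentGenSq μ x)

/-- Near κ the function is k log T(k) - ∫₀ᵏ log T; the two terms log T(κ) cancel in the derivative,
leaving κ T'(κ)/T(κ). -/
theorem hasDerivAt_rectEntropy (hlam : 0 ≤ lam) {κ : ℝ} (hκ : 0 ≤ κ) :
    HasDerivAt (rectEntropy lam) (κ * ((2 * lam * κ + lam + 1) / rectT lam κ)) κ := by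
  have hTpos : 0 < rectT lam κ := zero_lt_one.trans_le (one_le_rectT hlam hκ)
  have hT := hasDerivAt_rectT lam κ
  have hlogT := hT.log hTpos.ne'
  have hint : IntervalIntegrable (fun z => Real.log (rectT lam z)) volume 0 κ :=
    ((continuousOn_log_rectT hlam).mono fun z hz => (le_inf le_rfl hκ).trans hz.1).intervalIntegrable
  have hmeas : Measurable fun z => Real.log (rectT lam z) :=
    Real.measurable_log.comp (continuous_rectT lam).measurable
  have h3 := intervalIntegral.integral_hasDerivAt_right hint
    hmeas.stronglyMeasurable.stronglyMeasurableAtFilter hlogT.continuousAt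
  have h4 := ((hasDerivAt_id κ).mul hlogT).sub h3
  have h5 : ∀ᶠ k in 𝓝 κ, rectEntropy lam k =
      k * Real.log (rectT lam k) - ∫ z in (0 : ℝ)..k, Real.log (rectT lam z) := by
    have hopen : ∀ᶠ k in 𝓝 κ, IntervalIntegrable (fun z => Real.log (rectT lam z)) volume 0 k := by
      have hcT : ∀ᶠ z in 𝓝 κ, 0 < rectT lam z :=
        (continuous_rectT lam).continuousAt.eventually_const_lt hTpos
      obtain ⟨δ, hδ, hball⟩ := Metric.eventually_nhds_iff_ball.1 hcT
      filter_upwards [Metric.ball_mem_nhds κ hδ] with k hk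
      refine hint.trans (ContinuousOn.intervalIntegrable ?_)
      exact (continuous_rectT lam).continuousOn.log fun z hz => (hball z
        ((convex_ball κ δ).ordConnected.uIcc_subset (Metric.mem_ball_self hδ) hk hz)).ne'
    filter_upwards [hopen] with k hk
    rw [rectEntropy, intervalIntegral.integral_sub intervalIntegrable_const hk,
      intervalIntegral.integral_const, smul_eq_mul, sub_zero]
  refine (h4.congr_of_eventuallyEq h5).congr_deriv ?_
  simp

end Transform

/-! ### The limit as a primitive of the rectangular R-transform -/

section Primitive

variable {μ : Measure ℝ} {K lam : ℝ}

theorem hasDerivAt_rectPrimitive [IsProbabilityMeasure μ] (hK : 0 < K)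
    (hμ : ∀ᵐ t ∂μ, t ^ 2 ≤ K ^ 2) (hlam : 0 ≤ lam) {x : ℝ} (hx0 : 0 ≤ x) (hx : x < (K ^ 2)⁻¹) :
    HasDerivAt (rectPrimitive lam μ) (∫ t, t ^ 2 / (1 - t ^ 2 * x) ∂μ +
      momentGenSq μ x * ((2 * lam * momentGenSq μ x + lam + 1) / rectT lam (momentGenSq μ x)) *
        ∫ t, t ^ 2 / (1 - t ^ 2 * x) ^ 2 ∂μ) x :=
  (hasDerivAt_logPotentialSq hK hμ hx0 hx).add
    ((hasDerivAt_rectEntropy hlam (momentGenSq_nonneg hK hμ hx0 hx)).comp x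
      (hasDerivAt_momentGenSq hK hμ hx0 hx))

theorem rectPrimitive_zero : rectPrimitive lam μ 0 = 0 := by
  simp [rectPrimitive, logPotentialSq, momentGenSq_zero, rectEntropy]

/-- From y = x T(M) one gets dy/y = dx/x + (T'/T) dM. The differential of the primitive is (M/x) dx
+ M (T'/T) dM = M dy/y, and M = C(y). -/
theorem hasDerivAt_rectPrimitive_rectHInv [IsProbabilityMeasure μ] (hK : 0 < K)
    (hμ : ∀ᵐ t ∂μ, t ^ 2 ≤ K ^ 2) (hlam : lam ∈ Icc (0 : ℝ) 1) {y : ℝ}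
    (hy : y ∈ Ioo 0 (K ^ 2)⁻¹) :
    HasDerivAt (fun y => rectPrimitive lam μ (rectHInv K lam μ y))
      (rectRTransform K lam μ y / y) y := by
  have hy' : y ∈ Ico 0 (K ^ 2)⁻¹ := ⟨hy.1.le, hy.2⟩
  have hm := rectHInv_mem hK hμ hlam.1 hy'
  have hpos := rectHInv_pos hK hμ hlam.1 hy
  have hM := momentGenSq_nonneg hK hμ hm.1 hm.2
  have hTpos := zero_lt_one.trans_le (one_le_rectT hlam.1 hM)
  have hH := rectH_rectHInv hK hμ hlam.1 hy'
  have hcont : ContinuousAt (rectHInv K lam μ) y :=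
    (continuousOn_rectHInv hK hμ hlam.1).continuousAt (Ico_mem_nhds hy.1 hy.2)
  have hnn : 0 ≤ ∫ t, t ^ 2 / (1 - t ^ 2 * rectHInv K lam μ y) ^ 2 ∂μ :=
    integral_nonneg fun t => by positivity
  have hH' := hasDerivAt_rectH (lam := lam) hK hμ hm.1 hm.2
  have hl := hlam.1
  have hinv := hH'.of_local_left_inverse hcont (by positivity) (by
    filter_upwards [Ioo_mem_nhds hy.1 hy.2] with z hz
    exact rectH_rectHInv hK hμ hlam.1 ⟨hz.1.le, hz.2⟩)
  have := (hasDerivAt_rectPrimitive hK hμ hlam.1 hm.1 hm.2).comp y hinv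
  refine this.congr_deriv ?_
  have hMx := momentGenSq_eq_mul (μ := μ) (rectHInv K lam μ y)
  rw [rectRTransform_eq hK hμ hlam hy', mul_inv_eq_iff_eq_mul₀ (by positivity)]
  have hI : ∫ t, t ^ 2 / (1 - t ^ 2 * rectHInv K lam μ y) ∂μ =
      momentGenSq μ (rectHInv K lam μ y) / rectHInv K lam μ y := by
    rw [hMx, mul_div_cancel_left₀ _ hpos.ne']
  rw [hI]
  have hyH : y = rectHInv K lam μ y * rectT lam (momentGenSq μ (rectHInv K lam μ y)) := hH.symm
  generalize rectHInv K lam μ y = x at *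
  generalize momentGenSq μ x = M at *
  generalize rectT lam M = T at *
  subst hyH
  field_simp

theorem continuousOn_rectRTransform [IsProbabilityMeasure μ] (hK : 0 < K)
    (hμ : ∀ᵐ t ∂μ, t ^ 2 ≤ K ^ 2) (hlam : lam ∈ Icc (0 : ℝ) 1) :
    ContinuousOn (rectRTransform K lam μ) (Ico 0 (K ^ 2)⁻¹) := by
  have h1 : ContinuousOn (momentGenSq μ) (Ico 0 (K ^ 2)⁻¹) := fun x hx =>
    (hasDerivAt_momentGenSq hK hμ hx.1 hx.2).continuousAt.continuousWithinAt
  exact (h1.comp (continuousOn_rectHInv hK hμ hlam.1)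
    fun y hy => rectHInv_mem hK hμ hlam.1 hy).congr fun y hy => rectRTransform_eq hK hμ hlam hy

theorem sq_mem_of_mem_Ioo (hK : 0 < K) {t : ℝ} (ht : t ∈ Ioo (-K⁻¹) K⁻¹) :
    t ^ 2 ∈ Ico 0 (K ^ 2)⁻¹ := by
  refine ⟨sq_nonneg t, ?_⟩
  rw [← inv_pow]
  exact sq_lt_sq.2 (by rw [abs_of_pos (inv_pos.2 hK)]; exact abs_lt.2 ht)

theorem continuousOn_rectRTransform_sq_div [IsProbabilityMeasure μ] (hK : 0 < K)
    (hμ : ∀ᵐ t ∂μ, t ^ 2 ≤ K ^ 2) (hlam : lam ∈ Icc (0 : ℝ) 1) :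
    ContinuousOn (fun t : ℝ => rectRTransform K lam μ (t ^ 2) / t) (Ioo (-K⁻¹) K⁻¹) := by
  have hc : ContinuousOn (fun t : ℝ => rectRTransform K lam μ (t ^ 2)) (Ioo (-K⁻¹) K⁻¹) :=
    (continuousOn_rectRTransform hK hμ hlam).comp (by fun_prop)
      fun t ht => sq_mem_of_mem_Ioo hK ht
  intro t ht
  by_cases h0 : t = 0
  · subst h0
    have hnhds : Ioo (-K⁻¹) K⁻¹ ∈ 𝓝 (0 : ℝ) := Ioo_mem_nhds ht.1 ht.2
    refine ContinuousAt.continuousWithinAt ?_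
    have hlim : Tendsto (fun t : ℝ => |t| * (K ^ 2 / (1 - K ^ 2 * t ^ 2))) (𝓝 0) (𝓝 0) := by
      have : ContinuousAt (fun t : ℝ => |t| * (K ^ 2 / (1 - K ^ 2 * t ^ 2))) 0 := by
        refine continuous_abs.continuousAt.mul (ContinuousAt.div (by fun_prop) (by fun_prop) ?_)
        simp
      simpa [ContinuousAt] using this
    -- The value at 0 is 0 by the convention for division, and this is also the limit, since C(t²) =
    -- O(t²).
    rw [ContinuousAt, div_zero]
    refine squeeze_zero_norm' ?_ hlim
    filter_upwards [hnhds] with s hs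
    have hs2 := sq_mem_of_mem_Ioo hK hs
    have hm := rectHInv_mem hK hμ hlam.1 hs2
    have hle := (momentGenSq_monotoneOn hK hμ hm hs2 (rectHInv_le hK hμ hlam.1 hs2)).trans
      (momentGenSq_le hK hμ hs2.1 hs2.2)
    rw [norm_div, Real.norm_eq_abs, Real.norm_eq_abs, rectRTransform_eq hK hμ hlam hs2,
      abs_of_nonneg (momentGenSq_nonneg hK hμ hm.1 hm.2)]
    by_cases hs0 : s = 0
    · simp [hs0]
    rw [div_le_iff₀ (abs_pos.2 hs0)]
    refine hle.trans_eq ?_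
    rw [mul_right_comm, abs_mul_abs_self]
    ring
  · exact (hc t ht).div continuousWithinAt_id h0

theorem uIcc_subset_Ioo_inv (hK : 0 < K) {t : ℝ} (ht : t ∈ Ioo (-K⁻¹) K⁻¹) :
    uIcc 0 t ⊆ Ioo (-K⁻¹) K⁻¹ :=
  ordConnected_Ioo.uIcc_subset ⟨neg_lt_zero.2 (inv_pos.2 hK), inv_pos.2 hK⟩ ht

theorem intervalIntegrable_rectRTransform_sq_div [IsProbabilityMeasure μ] (hK : 0 < K)
    (hμ : ∀ᵐ t ∂μ, t ^ 2 ≤ K ^ 2) (hlam : lam ∈ Icc (0 : ℝ) 1) {t : ℝ}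
    (ht : t ∈ Ioo (-K⁻¹) K⁻¹) :
    IntervalIntegrable (fun t : ℝ => rectRTransform K lam μ (t ^ 2) / t) volume 0 t :=
  ((continuousOn_rectRTransform_sq_div hK hμ hlam).mono
    (uIcc_subset_Ioo_inv hK ht)).intervalIntegrable

theorem continuousOn_rectPrimitive_rectHInv_sq [IsProbabilityMeasure μ] (hK : 0 < K)
    (hμ : ∀ᵐ t ∂μ, t ^ 2 ≤ K ^ 2) (hlam : 0 ≤ lam) :
    ContinuousOn (fun t : ℝ => rectPrimitive lam μ (rectHInv K lam μ (t ^ 2)))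
      (Ioo (-K⁻¹) K⁻¹) := by
  have h1 : ContinuousOn (rectPrimitive lam μ) (Ico 0 (K ^ 2)⁻¹) := fun x hx =>
    (hasDerivAt_rectPrimitive hK hμ hlam hx.1 hx.2).continuousAt.continuousWithinAt
  exact (h1.comp (continuousOn_rectHInv hK hμ hlam)
    fun y hy => rectHInv_mem hK hμ hlam hy).comp (by fun_prop)
      fun t ht => sq_mem_of_mem_Ioo hK ht

theorem integral_rectRTransform_sq_div [IsProbabilityMeasure μ] (hK : 0 < K)
    (hμ : ∀ᵐ t ∂μ, t ^ 2 ≤ K ^ 2) (hlam : lam ∈ Icc (0 : ℝ) 1) {t : ℝ} (ht0 : 0 ≤ t)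
    (ht : t < K⁻¹) :
    ∫ s in (0 : ℝ)..t, rectRTransform K lam μ (s ^ 2) / s =
      rectPrimitive lam μ (rectHInv K lam μ (t ^ 2)) / 2 := by
  have htI : t ∈ Ioo (-K⁻¹) K⁻¹ := ⟨by linarith [inv_pos.2 hK], ht⟩
  have hsub : Icc 0 t ⊆ Ioo (-K⁻¹) K⁻¹ := by
    rw [← uIcc_of_le ht0]; exact uIcc_subset_Ioo_inv hK htI
  rw [intervalIntegral.integral_eq_sub_of_hasDerivAt_of_le
    (f := fun t => rectPrimitive lam μ (rectHInv K lam μ (t ^ 2)) / 2) ht0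
    (((continuousOn_rectPrimitive_rectHInv_sq hK hμ hlam.1).mono hsub).div_const 2) ?_
    (intervalIntegrable_rectRTransform_sq_div hK hμ hlam htI)]
  · simp [rectHInv_zero hK hμ hlam.1, rectPrimitive_zero]
  · intro s hs
    have hs2 := sq_mem_of_mem_Ioo hK (hsub ⟨hs.1.le, hs.2.le⟩)
    have hsq : HasDerivAt (fun s : ℝ => s ^ 2) (2 * s) s := by simpa using hasDerivAt_pow 2 s
    have hprim : HasDerivAt (fun y => rectPrimitive lam μ (rectHInv K lam μ y))
        (rectRTransform K lam μ (s ^ 2) / s ^ 2) ((fun s : ℝ => s ^ 2) s) :=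
      hasDerivAt_rectPrimitive_rectHInv hK hμ hlam ⟨by have := hs.1; positivity, hs2.2⟩
    -- With y = s², dy/y = 2 ds/s, whence the factor 1/2.
    refine ((HasDerivAt.comp (h := fun s : ℝ => s ^ 2) s hprim hsq).div_const 2).congr_deriv ?_
    have := hs.1.ne'
    field_simp

theorem rectLimit_eq_rectPrimitive [IsProbabilityMeasure μ] (hK : 0 < K)
    (hμ : ∀ᵐ t ∂μ, t ^ 2 ≤ K ^ 2) (hlam : lam ∈ Icc (0 : ℝ) 1) {b θ : ℝ}
    (hθ : θ / b ∈ Ioo (-K⁻¹) K⁻¹) :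
    rectLimit b K lam μ θ =
      b / 2 * rectPrimitive lam μ (rectHInv K lam μ ((θ / b) ^ 2)) := by
  unfold rectLimit
  rcases le_total 0 (θ / b) with h | h
  · rw [integral_rectRTransform_sq_div hK hμ hlam h hθ.2]
    ring
  · have h1 : ∫ s in (0 : ℝ)..(θ / b), rectRTransform K lam μ (s ^ 2) / s =
        ∫ s in (0 : ℝ)..(-(θ / b)), rectRTransform K lam μ (s ^ 2) / s := by
      have := intervalIntegral.integral_comp_neg (a := 0) (b := -(θ / b))
        (fun s : ℝ => rectRTransform K lam μ (s ^ 2) / s)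
      simp only [neg_sq, div_neg, intervalIntegral.integral_neg, neg_neg, neg_zero] at this
      rw [intervalIntegral.integral_symm 0 (θ / b)] at this
      linarith
    rw [h1, integral_rectRTransform_sq_div hK hμ hlam (by linarith) (by linarith [hθ.1]), neg_sq]
    ring

end Primitive

/-! ### Convergence of the singular laws -/

section SingularLaw

variable {𝕜 : Type*} [RCLike 𝕜]

theorem singularValue_nonneg {n m : ℕ} (M : Matrix (Fin n) (Fin m) 𝕜) (k : Fin n) :
    0 ≤ singularValue M k := LinearMap.singularValues_nonneg _ _

theorem integral_singularLaw {n m : ℕ} (M : Matrix (Fin n) (Fin m) 𝕜) (f : ℝ → ℝ) :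
    ∫ x, f x ∂(singularLaw M) = 1 / (n : ℝ) * ∑ k : Fin n, f (singularValue M k) := by
  rw [singularLaw, integral_smul_measure, integral_finsetSum_measure fun k _ =>
    integrable_dirac (by finiteness)]
  simp

variable {m : ℕ → ℕ} {M : ∀ n, Matrix (Fin n) (Fin (m n)) 𝕜} {K : ℝ} {μ : Measure ℝ}
  [IsProbabilityMeasure μ]

theorem ae_sq_le_of_tendsto_singularLaw (hK0 : 0 < K)
    (hK : ∀ n, ∀ k : Fin n, singularValue (M n) k < K)
    (hμ : ∀ f : BoundedContinuousFunction ℝ ℝ,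
      Tendsto (fun n : ℕ => ∫ x, f x ∂(singularLaw (M n))) atTop (𝓝 (∫ x, f x ∂μ))) :
    ∀ᵐ t ∂μ, t ^ 2 ≤ K ^ 2 := by
  -- A bounded test function that vanishes exactly on [-K, K], hence at every singular value.
  set f : ℝ → ℝ := fun t => min 1 (max 0 (|t| - K)) with hf
  have hfc : Continuous f := by fun_prop
  have hf0 : ∀ t, 0 ≤ f t := fun t => le_min zero_le_one (le_max_left _ _)
  have hfb : ∀ t, ‖f t‖ ≤ 1 := fun t => by
    rw [Real.norm_eq_abs, abs_of_nonneg (hf0 t)]; exact min_le_left _ _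
  have h := hμ (BoundedContinuousFunction.ofNormedAddCommGroup f hfc 1 hfb)
  have h0 : ∀ n, ∫ x, f x ∂(singularLaw (M n)) = 0 := by
    intro n
    rw [integral_singularLaw, Finset.sum_eq_zero, mul_zero]
    intro k _
    have h1 : |singularValue (M n) k| - K ≤ 0 := by
      rw [abs_of_nonneg (singularValue_nonneg _ _)]; linarith [hK n k]
    simp [hf, max_eq_left h1]
  simp only [BoundedContinuousFunction.coe_ofNormedAddCommGroup, h0] at h
  have h2 : ∫ x, f x ∂μ = 0 := (tendsto_nhds_unique h tendsto_const_nhds)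
  have hint : Integrable f μ := (integrable_const (1 : ℝ)).mono' hfc.aestronglyMeasurable
    (ae_of_all _ hfb)
  rw [integral_eq_zero_iff_of_nonneg hf0 hint] at h2
  filter_upwards [h2] with t ht
  have h3 : |t| ≤ K := by
    by_contra! hlt
    have : 0 < f t := lt_min zero_lt_one (lt_max_of_lt_right (sub_pos.2 hlt))
    rw [ht] at this
    exact lt_irrefl _ this
  exact sq_le_sq.2 (by rwa [abs_of_pos hK0])

theorem tendsto_logPotentialSq_singularLaw (hK0 : 0 < K)
    (hK : ∀ n, ∀ k : Fin n, singularValue (M n) k < K)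
    (hμ : ∀ f : BoundedContinuousFunction ℝ ℝ,
      Tendsto (fun n : ℕ => ∫ x, f x ∂(singularLaw (M n))) atTop (𝓝 (∫ x, f x ∂μ)))
    {x : ℝ} (hx0 : 0 ≤ x) (hx : x < (K ^ 2)⁻¹) :
    Tendsto (fun n => logPotentialSq (singularLaw (M n)) x) atTop (𝓝 (logPotentialSq μ x)) := by
  have hKx := sq_mul_lt_one hK0 (le_refl (K ^ 2)) hx0 hx
  -- Clipping t² at K² makes the integrand bounded and continuous on ℝ without changing it on the
  -- supports.
  set f : ℝ → ℝ := fun t => -Real.log (1 - min (t ^ 2) (K ^ 2) * x) with hf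
  have hlow : ∀ t : ℝ, 1 - K ^ 2 * x ≤ 1 - min (t ^ 2) (K ^ 2) * x := fun t => by
    have := mul_le_mul_of_nonneg_right (min_le_right (t ^ 2) (K ^ 2)) hx0
    linarith
  have hpos : ∀ t : ℝ, 0 < 1 - min (t ^ 2) (K ^ 2) * x := fun t => by linarith [hlow t]
  have hfc : Continuous f := (Continuous.log (by fun_prop) fun t => (hpos t).ne').neg
  have hfb : ∀ t, ‖f t‖ ≤ -Real.log (1 - K ^ 2 * x) := fun t => by
    have h1 := Real.log_le_log (by linarith) (hlow t)
    have h2 : Real.log (1 - min (t ^ 2) (K ^ 2) * x) ≤ 0 := by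
      refine Real.log_nonpos (hpos t).le ?_
      have : 0 ≤ min (t ^ 2) (K ^ 2) * x := mul_nonneg (by positivity) hx0
      linarith
    rw [norm_neg, Real.norm_eq_abs, abs_of_nonpos h2]
    linarith
  have h := hμ (BoundedContinuousFunction.ofNormedAddCommGroup f hfc _ hfb)
  simp only [BoundedContinuousFunction.coe_ofNormedAddCommGroup] at h
  have e1 : ∀ n, ∫ t, f t ∂(singularLaw (M n)) = logPotentialSq (singularLaw (M n)) x := by
    intro n
    rw [logPotentialSq, integral_singularLaw, integral_singularLaw]
    congr 1
    refine Finset.sum_congr rfl fun k _ => ?_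
    have : singularValue (M n) k ^ 2 ≤ K ^ 2 :=
      pow_le_pow_left₀ (singularValue_nonneg _ _) (hK n k).le 2
    simp only [hf, min_eq_left this]
  have e2 : ∫ t, f t ∂μ = logPotentialSq μ x := by
    refine integral_congr_ae ?_
    filter_upwards [ae_sq_le_of_tendsto_singularLaw hK0 hK hμ] with t ht
    simp only [hf, min_eq_left ht]
  simpa only [e1, e2] using h

end SingularLaw

/-! ### From pointwise to uniform convergence -/

/-- Around each point, monotonicity traps F n between its values at two nearby points of [a, b],
where pointwise convergence applies and f varies little; compactness does the rest. -/
theorem tendstoUniformlyOn_Icc_of_monotoneOn {F : ℕ → ℝ → ℝ} {f : ℝ → ℝ} {a b : ℝ}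
    (hF : ∀ᶠ n in atTop, MonotoneOn (F n) (Icc a b)) (hf : ContinuousOn f (Icc a b))
    (hlim : ∀ t ∈ Icc a b, Tendsto (fun n => F n t) atTop (𝓝 (f t))) :
    TendstoUniformlyOn F f atTop (Icc a b) := by
  rw [← tendstoLocallyUniformlyOn_iff_tendstoUniformlyOn_of_compact isCompact_Icc,
    Metric.tendstoLocallyUniformlyOn_iff]
  intro ε hε t ht
  obtain ⟨δ, hδ, hδf⟩ := Metric.continuousWithinAt_iff.1 (hf t ht) (ε / 4) (by positivity)
  set u := max a (t - δ / 2) with hu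
  set v := min b (t + δ / 2) with hv
  have hut : u ≤ t := max_le ht.1 (by linarith)
  have htv : t ≤ v := le_min ht.2 (by linarith)
  have huI : u ∈ Icc a b := ⟨le_max_left _ _, hut.trans ht.2⟩
  have hvI : v ∈ Icc a b := ⟨ht.1.trans htv, min_le_left _ _⟩
  have hclose : ∀ s ∈ Icc u v, |f s - f t| < ε / 4 := by
    intro s hs
    have hsI : s ∈ Icc a b := ⟨huI.1.trans hs.1, hs.2.trans hvI.2⟩
    refine hδf hsI ?_
    have h1 : t - δ / 2 ≤ s := (le_max_right _ _).trans hs.1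
    have h2 : s ≤ t + δ / 2 := hs.2.trans (min_le_right _ _)
    rw [Real.dist_eq, abs_lt]
    constructor <;> linarith
  refine ⟨Icc u v, ?_, ?_⟩
  · rw [mem_nhdsWithin_iff_exists_mem_nhds_inter]
    refine ⟨Icc (t - δ / 2) (t + δ / 2), Icc_mem_nhds (by linarith) (by linarith), ?_⟩
    rintro s ⟨hs1, hs2⟩
    exact ⟨max_le hs2.1 hs1.1, le_min hs2.2 hs1.2⟩
  · filter_upwards [hF, Metric.tendsto_nhds.1 (hlim u huI) (ε / 4) (by positivity),
      Metric.tendsto_nhds.1 (hlim v hvI) (ε / 4) (by positivity)] with n hn h1 h2 s hs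
    have hsI : s ∈ Icc a b := ⟨huI.1.trans hs.1, hs.2.trans hvI.2⟩
    have g1 := hn huI hsI hs.1
    have g2 := hn hsI hvI hs.2
    have c1 := abs_lt.1 (hclose u ⟨le_rfl, hut.trans htv⟩)
    have c2 := abs_lt.1 (hclose v ⟨hut.trans htv, le_rfl⟩)
    have c3 := abs_lt.1 (hclose s hs)
    rw [Real.dist_eq, abs_lt] at h1 h2
    rw [Real.dist_eq, abs_lt]
    constructor <;> linarith

/-! ### Convergence of the spherical integrals -/

section Main

variable {𝕜 : Type*} [RCLike 𝕜]

/-- The spherical integral as a function of `t = θ / β`, given by its power series. -/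
noncomputable def sphericalSeries {n m : ℕ} (M : Matrix (Fin n) (Fin m) 𝕜) (t : ℝ) : ℝ :=
  ∑' k : ℕ, singularCoeff M k * (t ^ 2) ^ k /
    ∏ i ∈ Finset.range k, rectT ((n : ℝ) / m) (i / (betaIndex 𝕜 * n / 2))

variable {n m : ℕ} {K : ℝ}

theorem one_le_prod_rectT (k : ℕ) :
    1 ≤ ∏ i ∈ Finset.range k, rectT ((n : ℝ) / m) (i / (betaIndex 𝕜 * n / 2)) := by
  have hb := betaIndex_pos (𝕜 := 𝕜)
  refine Finset.one_le_prod fun i _ => ?_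
  exact one_le_rectT (by positivity) (by positivity)

theorem singularCoeff_zero [NeZero n] [NeZero m] (hnm : n ≤ m) (M : Matrix (Fin n) (Fin m) 𝕜) :
    singularCoeff M 0 = 1 := by
  have h1 := hasSum_singularCoeff hnm M (le_refl (0 : ℝ)) (by simp)
  have h2 := hasSum_single (f := fun k => singularCoeff M k * (0 : ℝ) ^ k) 0
    (fun k hk => by simp [hk])
  simpa using h2.unique h1

theorem singularValue_sq_mul_lt_one (hK0 : 0 < K) {M : Matrix (Fin n) (Fin m) 𝕜}
    (hK : ∀ k : Fin n, singularValue M k < K) {x : ℝ} (hx0 : 0 ≤ x) (hx : x < (K ^ 2)⁻¹)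
    (k : Fin n) : singularValue M k ^ 2 * x < 1 :=
  sq_mul_lt_one hK0 (pow_le_pow_left₀ (singularValue_nonneg _ _) (hK k).le 2) hx0 hx

theorem summable_sphericalSeries [NeZero n] [NeZero m] (hnm : n ≤ m) (hK0 : 0 < K)
    {M : Matrix (Fin n) (Fin m) 𝕜} (hK : ∀ k : Fin n, singularValue M k < K) {t : ℝ}
    (ht : t ∈ Ioo (-K⁻¹) K⁻¹) :
    Summable fun k : ℕ => singularCoeff M k * (t ^ 2) ^ k /
      ∏ i ∈ Finset.range k, rectT ((n : ℝ) / m) (i / (betaIndex 𝕜 * n / 2)) := by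
  have ht2 := sq_mem_of_mem_Ioo hK0 ht
  have hs := (hasSum_singularCoeff hnm M ht2.1
    (singularValue_sq_mul_lt_one hK0 hK ht2.1 ht2.2)).summable
  have hnn : ∀ k, 0 ≤ singularCoeff M k * (t ^ 2) ^ k := fun k =>
    mul_nonneg (singularCoeff_nonneg M k) (by positivity)
  exact hs.of_nonneg_of_le
    (fun k => div_nonneg (hnn k) (zero_le_one.trans (one_le_prod_rectT k)))
    fun k => div_le_self (hnn k) (one_le_prod_rectT k)

theorem sphericalSeries_pos [NeZero n] [NeZero m] (hnm : n ≤ m) (hK0 : 0 < K)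
    {M : Matrix (Fin n) (Fin m) 𝕜} (hK : ∀ k : Fin n, singularValue M k < K) {t : ℝ}
    (ht : t ∈ Ioo (-K⁻¹) K⁻¹) : 0 < sphericalSeries M t := by
  refine (summable_sphericalSeries hnm hK0 hK ht).tsum_pos (fun k => ?_) 0 ?_
  · exact div_nonneg (mul_nonneg (singularCoeff_nonneg M k) (by positivity))
      (zero_le_one.trans (one_le_prod_rectT k))
  · simp [singularCoeff_zero hnm]

theorem sphericalSeries_zero [NeZero n] [NeZero m] (hnm : n ≤ m) (M : Matrix (Fin n) (Fin m) 𝕜) :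
    sphericalSeries M 0 = 1 := by
  unfold sphericalSeries
  rw [tsum_eq_single 0 fun k hk => by simp [hk]]
  simp [singularCoeff_zero hnm]

theorem monotoneOn_log_sphericalSeries [NeZero n] [NeZero m] (hnm : n ≤ m) (hK0 : 0 < K)
    {M : Matrix (Fin n) (Fin m) 𝕜} (hK : ∀ k : Fin n, singularValue M k < K) :
    MonotoneOn (fun t => 1 / (n : ℝ) * Real.log (sphericalSeries M t)) (Ico 0 K⁻¹) := by
  have hKi := inv_pos.2 hK0
  intro t ht t' ht' h
  have hI : t ∈ Ioo (-K⁻¹) K⁻¹ := ⟨by linarith [ht.1], ht.2⟩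
  have hI' : t' ∈ Ioo (-K⁻¹) K⁻¹ := ⟨by linarith [ht'.1], ht'.2⟩
  refine mul_le_mul_of_nonneg_left (Real.log_le_log (sphericalSeries_pos hnm hK0 hK hI) ?_)
    (by positivity)
  refine (summable_sphericalSeries hnm hK0 hK hI).tsum_le_tsum (fun k => ?_)
    (summable_sphericalSeries hnm hK0 hK hI')
  refine div_le_div_of_nonneg_right ?_ (zero_le_one.trans (one_le_prod_rectT k))
  have := ht.1
  exact mul_le_mul_of_nonneg_left (by gcongr) (singularCoeff_nonneg M k)

theorem rectSphericalIntegral_eq [NeZero n] [NeZero m]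
    (M : Matrix (Fin n) (Fin m) 𝕜) {Ω : Type*} [MeasurableSpace Ω] (P : Measure Ω)
    [IsProbabilityMeasure P] {U : Ω → Matrix.unitaryGroup (Fin n) 𝕜}
    {V : Ω → Matrix.unitaryGroup (Fin m) 𝕜} (hU : IsHaarDistributed P U)
    (hV : IsHaarDistributed P V) (hUV : IndepFun U V P) {E : Matrix (Fin m) (Fin n) 𝕜}
    (hE : IsElementary E) (θ : ℝ) :
    rectSphericalIntegral P E U M V θ =
      1 / (n : ℝ) * Real.log (sphericalSeries M |θ / betaIndex 𝕜|) := by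
  rw [rectSphericalIntegral, integral_exp_trace_eq_tsum M P hU hV hUV hE, sphericalSeries, sq_abs]

/-- Puts the generating function in the form exp(N φₙ(x)), N = βn/2, required by the Laplace
argument. -/
theorem prod_rpow_eq_exp_logPotentialSq [NeZero n] (hK0 : 0 < K)
    {M : Matrix (Fin n) (Fin m) 𝕜} (hK : ∀ k : Fin n, singularValue M k < K) {x : ℝ}
    (hx0 : 0 ≤ x) (hx : x < (K ^ 2)⁻¹) (b : ℝ) :
    ∏ j : Fin n, (1 - singularValue M j ^ 2 * x) ^ (-(b / 2)) =
      Real.exp (b * n / 2 * logPotentialSq (singularLaw M) x) := by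
  have hn : (n : ℝ) ≠ 0 := Nat.cast_ne_zero.2 (NeZero.ne n)
  have h1 : b * n / 2 * logPotentialSq (singularLaw M) x =
      ∑ k : Fin n, Real.log (1 - singularValue M k ^ 2 * x) * (-(b / 2)) := by
    rw [logPotentialSq, integral_singularLaw, Finset.sum_neg_distrib, ← Finset.sum_mul]
    generalize ∑ k : Fin n, Real.log (1 - singularValue M k ^ 2 * x) = S
    field_simp
  rw [h1, Real.exp_sum]
  refine Finset.prod_congr rfl fun j _ => ?_
  rw [Real.rpow_def_of_pos (by linarith [singularValue_sq_mul_lt_one hK0 hK hx0 hx j])]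

theorem tendsto_log_sphericalSeries {m : ℕ → ℕ} (hm : ∀ n, 1 ≤ n → n ≤ m n)
    {lam : ℝ} (hlam : lam ∈ Icc (0 : ℝ) 1)
    (hratio : Tendsto (fun n : ℕ => (n : ℝ) / (m n : ℝ)) atTop (𝓝 lam))
    {M : ∀ n, Matrix (Fin n) (Fin (m n)) 𝕜} (hK0 : 0 < K)
    (hK : ∀ n, ∀ k : Fin n, singularValue (M n) k < K) {μ : Measure ℝ} [IsProbabilityMeasure μ]
    (hμ : ∀ f : BoundedContinuousFunction ℝ ℝ,
      Tendsto (fun n : ℕ => ∫ x, f x ∂(singularLaw (M n))) atTop (𝓝 (∫ x, f x ∂μ)))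
    {t : ℝ} (ht : t ∈ Ico 0 K⁻¹) :
    Tendsto (fun n : ℕ => 1 / (n : ℝ) * Real.log (sphericalSeries (M n) t)) atTop
      (𝓝 (betaIndex 𝕜 / 2 * rectPrimitive lam μ (rectHInv K lam μ (t ^ 2)))) := by
  have hb := betaIndex_pos (𝕜 := 𝕜)
  have hsupp := ae_sq_le_of_tendsto_singularLaw hK0 hK hμ
  have hne : ∀ n, 1 ≤ n → NeZero n ∧ NeZero (m n) := fun n hn =>
    ⟨⟨by omega⟩, ⟨by have := hm n hn; omega⟩⟩
  -- The Laplace argument needs x > 0, so t = 0, where both sides vanish, is separate.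
  rcases ht.1.eq_or_lt with h0 | hpos
  · rw [← h0, zero_pow two_ne_zero, rectHInv_zero hK0 hsupp hlam.1, rectPrimitive_zero, mul_zero]
    refine tendsto_const_nhds.congr' ?_
    filter_upwards [eventually_ge_atTop 1] with n hn
    obtain ⟨_, _⟩ := hne n hn
    rw [sphericalSeries_zero (hm n hn), Real.log_one, mul_zero]
  have hy : t ^ 2 ∈ Ico 0 (K ^ 2)⁻¹ :=
    sq_mem_of_mem_Ioo hK0 ⟨by linarith [inv_pos.2 hK0], ht.2⟩
  have hx := rectHInv_mem hK0 hsupp hlam.1 hy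
  have hxpos := rectHInv_pos hK0 hsupp hlam.1 (y := t ^ 2) ⟨by positivity, hy.2⟩
  have hyx := rectH_rectHInv hK0 hsupp hlam.1 hy
  set x := rectHInv K lam μ (t ^ 2)
  have hderiv : HasDerivAt (logPotentialSq μ) (momentGenSq μ x / x) x := by
    refine (hasDerivAt_logPotentialSq hK0 hsupp hx.1 hx.2).congr_deriv ?_
    rw [momentGenSq_eq_mul, mul_div_cancel_left₀ _ hxpos.ne']
  have hN : Tendsto (fun n : ℕ => betaIndex 𝕜 * (n : ℝ) / 2) atTop atTop :=
    (tendsto_natCast_atTop_atTop.const_mul_atTop hb).atTop_div_const two_pos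
  have hlim := tendsto_log_weighted_series hN (l := fun n : ℕ => (n : ℝ) / m n)
    (fun n => by positivity) hratio
    (p := fun n => singularCoeff (M n)) (fun n => singularCoeff_nonneg (M n))
    (φn := fun n => logPotentialSq (singularLaw (M n))) (R := (K ^ 2)⁻¹)
    (fun x hx0 hxR => by
      filter_upwards [eventually_ge_atTop 1] with n hn
      obtain ⟨_, _⟩ := hne n hn
      rw [← prod_rpow_eq_exp_logPotentialSq hK0 (hK n) hx0.le hxR]
      exact hasSum_singularCoeff (hm n hn) (M n) hx0.le
        (singularValue_sq_mul_lt_one hK0 (hK n) hx0.le hxR))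
    (fun x hx0 hxR => tendsto_logPotentialSq_singularLaw hK0 hK hμ hx0.le hxR)
    hxpos hx.2 (momentGenSq_nonneg hK0 hsupp hx.1 hx.2) hderiv
  -- The choice κ = M(x) with H(x) = t² makes the argument of the series exactly t².
  have hyx' : x * rectT lam (momentGenSq μ x) = t ^ 2 := hyx
  rw [hyx'] at hlim
  refine (hlim.const_mul (betaIndex 𝕜 / 2)).congr' ?_
  filter_upwards [eventually_ge_atTop 1] with n hn
  have hn0 : (n : ℝ) ≠ 0 := by positivity
  rw [← mul_assoc, sphericalSeries]
  congr 1
  field_simp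

end Main

/-! ### Uniform convergence on compact sets -/

theorem theorem1 {𝕜 : Type*} [RCLike 𝕜]
    (m : ℕ → ℕ) (hm : ∀ n, 1 ≤ n → n ≤ m n)
    (lam : ℝ) (hlam : lam ∈ Icc (0 : ℝ) 1)
    (hratio : Tendsto (fun n : ℕ => (n : ℝ) / (m n : ℝ)) atTop (𝓝 lam))
    (hflat : lam = 0 → ∃ α : ℝ, α < 2 ∧ ∀ᶠ n : ℕ in atTop, (m n : ℝ) ≤ (n : ℝ) ^ α)
    (M : ∀ n, Matrix (Fin n) (Fin (m n)) 𝕜)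
    (K : ℝ) (hK : ∀ n, ∀ k : Fin n, singularValue (M n) k < K)
    (μ : Measure ℝ) [IsProbabilityMeasure μ]
    (hμ : ∀ f : BoundedContinuousFunction ℝ ℝ,
      Tendsto (fun n : ℕ => ∫ x, f x ∂(singularLaw (M n))) atTop (𝓝 (∫ x, f x ∂μ)))
    (Ω : ℕ → Type*) [∀ n, MeasurableSpace (Ω n)]
    (P : ∀ n, Measure (Ω n)) [∀ n, IsProbabilityMeasure (P n)]
    (U : ∀ n, Ω n → Matrix.unitaryGroup (Fin n) 𝕜)
    (V : ∀ n, Ω n → Matrix.unitaryGroup (Fin (m n)) 𝕜)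
    (hU : ∀ n, 1 ≤ n → IsHaarDistributed (P n) (U n))
    (hV : ∀ n, 1 ≤ n → IsHaarDistributed (P n) (V n))
    (hUV : ∀ n, 1 ≤ n → IndepFun (U n) (V n) (P n))
    (E : ∀ n, Matrix (Fin (m n)) (Fin n) 𝕜)
    (hE : ∀ n, 1 ≤ n → IsElementary (E n)) :
    (∀ θ ∈ Ioo (-(betaIndex 𝕜 * K⁻¹)) (betaIndex 𝕜 * K⁻¹),
      IntervalIntegrable (fun t : ℝ => rectRTransform K lam μ (t ^ 2) / t) volume
        0 (θ / betaIndex 𝕜)) ∧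
    ∀ S : Set ℝ, IsCompact S → S ⊆ Ioo (-(betaIndex 𝕜 * K⁻¹)) (betaIndex 𝕜 * K⁻¹) →
      TendstoUniformlyOn
        (fun n θ => rectSphericalIntegral (P n) (E n) (U n) (M n) (V n) θ)
        (rectLimit (betaIndex 𝕜) K lam μ) atTop S := by
  have hb := betaIndex_pos (𝕜 := 𝕜)
  -- The single singular value of M 1 already forces K > 0.
  have hK0 : 0 < K := (singularValue_nonneg (M 1) 0).trans_lt (hK 1 0)
  have hsupp := ae_sq_le_of_tendsto_singularLaw hK0 hK hμ
  have hdiv : ∀ θ ∈ Ioo (-(betaIndex 𝕜 * K⁻¹)) (betaIndex 𝕜 * K⁻¹),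
      θ / betaIndex 𝕜 ∈ Ioo (-K⁻¹) K⁻¹ := fun θ hθ => by
    constructor
    · rw [lt_div_iff₀ hb]; linarith [hθ.1]
    · rw [div_lt_iff₀ hb]; linarith [hθ.2]
  refine ⟨fun θ hθ => intervalIntegrable_rectRTransform_sq_div hK0 hsupp hlam (hdiv θ hθ),
    fun S hS hSsub => ?_⟩
  rcases S.eq_empty_or_nonempty with rfl | hne
  · exact tendstoUniformlyOn_empty
  -- All functions depend only on |θ/β|, so uniformity on S follows from uniformity on [0, a], a
  -- being the maximum of |θ/β| over S; compactness gives a < K⁻¹.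
  obtain ⟨θ₀, hθ₀, hmax⟩ := hS.exists_isMaxOn hne
    (f := fun θ : ℝ => |θ / betaIndex 𝕜|) (by fun_prop)
  set a := |θ₀ / betaIndex 𝕜| with ha
  have haK : a < K⁻¹ := abs_lt.2 (hdiv θ₀ (hSsub hθ₀))
  have hsub : Icc 0 a ⊆ Ico 0 K⁻¹ := fun t ht => ⟨ht.1, ht.2.trans_lt haK⟩
  have hunif := tendstoUniformlyOn_Icc_of_monotoneOn (a := 0) (b := a)
    (F := fun n t => 1 / (n : ℝ) * Real.log (sphericalSeries (M n) t))
    (f := fun t => betaIndex 𝕜 / 2 * rectPrimitive lam μ (rectHInv K lam μ (t ^ 2)))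
    (by
      filter_upwards [eventually_ge_atTop 1] with n hn
      have : NeZero n := ⟨by omega⟩
      have : NeZero (m n) := ⟨by have := hm n hn; omega⟩
      exact (monotoneOn_log_sphericalSeries (hm n hn) hK0 (hK n)).mono hsub)
    (continuousOn_const.mul ((continuousOn_rectPrimitive_rectHInv_sq hK0 hsupp hlam.1).mono
      fun t ht => ⟨by linarith [ht.1, inv_pos.2 hK0], (hsub ht).2⟩))
    fun t ht => tendsto_log_sphericalSeries hm hlam hratio hK0 hK hμ (hsub ht)
  have hcomp := (hunif.comp fun θ : ℝ => |θ / betaIndex 𝕜|).mono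
    (s' := S) fun θ hθ => ⟨abs_nonneg _, hmax hθ⟩
  refine (hcomp.congr ?_).congr_right ?_
  · filter_upwards [eventually_ge_atTop 1] with n hn θ _
    have : NeZero n := ⟨by omega⟩
    have : NeZero (m n) := ⟨by have := hm n hn; omega⟩
    exact (rectSphericalIntegral_eq (M n) (P n) (hU n hn) (hV n hn) (hUV n hn) (hE n hn) θ).symm
  · intro θ hθ
    simp only [Function.comp_apply, sq_abs]
    exact (rectLimit_eq_rectPrimitive hK0 hsupp hlam (hdiv θ (hSsub hθ))).symm
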